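/- **Setting.** Let $H$ be a hypergraph on the vertex set $\{1,\dots,n\}$ and let $K$ be a field of characteristic zero. For $r\ge -1$ consider the ordered set partitions $(B_1,\dots,B_{r+2})$ of $\{1,\dots,n\}$ into nonempty blocks such that at least one $B_i$ contains a hyperedge of $H$. Identify $(B_1,\dots,B_{r+2})$ with $(-1)^{r+1}(B_2,\dots,B_{r+2},B_1)$; each class $[B_1,\dots,B_{r+2}]$ is represented by its unique member with $1\in B_1$. Let $C_r$ be the $K$-vector space with these classes as basis, and let $$\partial_r[B_1,\dots,B_{r+2}]=\sum_{i=1}^{r+1}(-1)^{i+1}[B_1,\dots,B_i\cup B_{i+1},\dots,B_{r+2}]+(-1)^{r+3}[B_1\cup B_{r+2},B_2,\dots,B_{r+1}]$$ for $r\ge 0$, and $\partial_{-1}=0$. The complex $\Delta(H)=(C_\bullet,\partial_\bullet)$ is the cyclic coloring complex of $H$, and $HC_r(\Delta(H))=\ker\partial_r/\operatorname{im}\partial_{r+1}$. A star hypergraph of rank $k$ is a hypergraph all of whose hyperedges have size $k$ and contain a common set of $k-1$ vertices, and in which every vertex lies in some hyperedge. **Corollary 4.2.** Let $k\ge 2$.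 Let $H$ be a hypergraph on $n$ vertices consisting of a star hypergraph of rank $k$ with at least two hyperedges on $l$ of the vertices, together with $n-l$ singleton vertices (vertices in no hyperedge). Let $G$ be the graph obtained by contracting the common set of $k-1$ vertices of the hyperedges to a single vertex; it has $n-k+2$ vertices. Let $\chi_G$ be its chromatic polynomial, so that $\chi_G(m)$ is the number of proper colorings of all vertices of $G$ with $m$ colors, and put $$D=\frac{1}{(n-l+1)!}\left|\chi_G^{(n-l+1)}(0)\right| .$$ Then $$\dim HC_{n-k-1}(\Delta(H))=D+(l-k).$$ For every integer $r\ge l-k-1$, $$\dim HC_r(\Delta(H))=\binom{n-k+1}{r+1}-\binom{n-l+1}{(n-k)-r}+\binom{n-l}{(n-k)-(r+1)}\,D ,$$ and for every integer $r$ with $-1\le r<l-k-1$, $$\dim HC_r(\Delta(H))=\binom{n-k+1}{r+1}.$$ Here $\binom{a}{b}=0$ for $b<0$. -/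

import Mathlib

open Polynomial

namespace CyclicColoring

noncomputable section

/-- `H` is a star hypergraph of rank `k` with core `S`: all hyperedges have size `k`, every vertex
lies in some hyperedge (no singleton vertices), and `S` is a set of size `k - 1` contained in all
the hyperedges. -/
structure IsStarHypergraph {V : Type*} (H : Hypergraph V) (k : ℕ) (S : Set V) : Prop where
  uniform : ∀ e ∈ H.edgeSet, e.ncard = k
  no_singleton : ∀ v ∈ H.vertexSet, ∃ e ∈ H.edgeSet, v ∈ e
  core_finite : S.Finite
  core_card : S.ncard + 1 = k
  core_subset : ∀ e ∈ H.edgeSet, S ⊆ e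

/-- The vertices after contraction of `S`: the vertices outside `S`, and one new vertex `none`
which replaces `S`. -/
abbrev ContractedVertex {V : Type*} (S : Set V) : Type _ := Option {v : V // v ∉ S}

open Classical in
/-- The contraction map on vertices: it collapses `S` to `none`. -/
def contractVertex {V : Type*} (S : Set V) (v : V) : ContractedVertex S :=
  if h : v ∈ S then none else some ⟨v, h⟩

/-- The graph obtained from a hypergraph by contracting the vertex set `S` to one vertex: its edges
are the two-element images of the hyperedges. -/
def contractedGraph {V : Type*} (H : Hypergraph V) (S : Set V) :
    SimpleGraph (ContractedVertex S) where
  Adj a b := a ≠ b ∧ ∃ e ∈ H.edgeSet, contractVertex S '' e = {a, b}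
  symm := ⟨fun a b h => ⟨h.1.symm, by
    obtain ⟨e, he, h'⟩ := h.2
    exact ⟨e, he, by rw [h', Set.pair_comm]⟩⟩⟩
  loopless := ⟨fun _ h => h.1 rfl⟩

/-- The chromatic polynomial of a finite graph, written as `∑ⱼ sⱼ · (X choose j)` where `sⱼ` is the
number of proper colorings that use all of `j` given colors. It is characterized by
`chromaticPolynomial_eval` below. -/
def chromaticPolynomial {W : Type*} (G : SimpleGraph W) : ℚ[X] :=
  ∑ j ∈ Finset.range (Nat.card W + 1),
    C ((Nat.card {c : G.Coloring (Fin j) // Function.Surjective c} : ℚ) / (j.factorial : ℚ)) *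
      descPochhammer ℚ j

/-- An ordered set partition `[B₁, …, B_{p+1}]` of the vertices is recorded by the surjection
`f : V → Fin (p + 1)` that sends a vertex to the (zero-based) index of its block.  The faces with
`p + 1` blocks are those where some block contains a hyperedge of `H`.  Two of them that differ by
a cyclic rotation of the blocks are identified up to the sign `(-1) ^ p` of the rotation; each
class is represented by its unique member whose first block contains the distinguished vertex `v₀`
(the vertex labelled `1`). -/
abbrev Face {V : Type*} (H : Hypergraph V) (v₀ : V) (p : ℕ) : Type _ :=
  {f : V → Fin (p + 1) // Function.Surjective f ∧ f v₀ = 0 ∧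
    ∃ e ∈ H.edgeSet, ∃ i : Fin (p + 1), ∀ v ∈ e, f v = i}

/-- The effect on block indices of merging two cyclically adjacent blocks of `p + 2` blocks: for
`i ≤ p` the blocks with indices `i` and `i + 1` are merged, and for `i = p + 1` the last block is
merged into the first one. -/
def merge {p : ℕ} (i j : Fin (p + 2)) : Fin (p + 1) :=
  if (j : ℕ) ≤ i then Fin.ofNat (p + 1) j else ⟨j - 1, by omega⟩

theorem merge_val {p : ℕ} (i j : Fin (p + 2)) :
    (merge i j : ℕ) = if (j : ℕ) ≤ i then (if (j : ℕ) = p + 1 then 0 else (j : ℕ))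
      else (j : ℕ) - 1 := by
  unfold merge
  split_ifs with h1 h2
  · simp [h2]
  · simp only [Fin.val_ofNat]
    exact Nat.mod_eq_of_lt (by omega)
  · rfl

theorem merge_zero {p : ℕ} (i : Fin (p + 2)) : merge i 0 = 0 := by
  apply Fin.ext; simp [merge_val]

theorem merge_surjective {p : ℕ} (i : Fin (p + 2)) : Function.Surjective (merge i) := by
  intro b
  by_cases h : (b : ℕ) ≤ i
  · refine ⟨b.castSucc, Fin.ext ?_⟩
    have := b.isLt
    rw [merge_val, Fin.val_castSucc, if_pos h, if_neg (by omega)]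
  · refine ⟨b.succ, Fin.ext ?_⟩
    rw [merge_val, Fin.val_succ, if_neg (by omega)]
    omega

/-- The face obtained by merging two cyclically adjacent blocks. -/
def mergeFace {V : Type*} {H : Hypergraph V} {v₀ : V} {p : ℕ} (i : Fin (p + 2))
    (f : Face H v₀ (p + 1)) : Face H v₀ p :=
  ⟨fun v => merge i (f.1 v), (merge_surjective i).comp f.2.1,
    by simp only [f.2.2.1, merge_zero], by
      obtain ⟨e, he, j, hj⟩ := f.2.2.2
      exact ⟨e, he, merge i j, fun v hv => by simp only [hj v hv]⟩⟩

/-- The chain space of degree `p - 1` (spanned by the faces with `p + 1` blocks). -/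
abbrev Chain (K : Type*) [Field K] {V : Type*} (H : Hypergraph V) (v₀ : V) (p : ℕ) : Type _ :=
  Face H v₀ p →₀ K

/-- The boundary map `∂_p`, from degree `p` to degree `p - 1`: the alternating sum of the `p + 2`
merges of cyclically adjacent blocks. -/
def boundary (K : Type*) [Field K] {V : Type*} (H : Hypergraph V) (v₀ : V) (p : ℕ) :
    Chain K H v₀ (p + 1) →ₗ[K] Chain K H v₀ p :=
  Finsupp.lsum K fun f => ∑ i : Fin (p + 2),
    (-1 : K) ^ (i : ℕ) • Finsupp.lsingle (mergeFace i f)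

/-- The cycles of degree `p - 1`; in degree `-1` every chain is a cycle. -/
def cycles (K : Type*) [Field K] {V : Type*} (H : Hypergraph V) (v₀ : V) :
    (p : ℕ) → Submodule K (Chain K H v₀ p)
  | 0 => ⊤
  | p + 1 => LinearMap.ker (boundary K H v₀ p)

/-- The quotient `Z / B` of two submodules (of `Z` by the submodule of those elements of `Z` that
lie in `B`). -/
abbrev Subquotient {K M : Type*} [Field K] [AddCommGroup M] [Module K M] (Z B : Submodule K M) :
    Type _ :=
  Z ⧸ B.submoduleOf Z

/-- The homology `ker ∂_r / im ∂_{r+1}` of the cyclic coloring complex of `H`, for `r ≥ -1`. -/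
abbrev HC (K : Type*) [Field K] {V : Type*} (H : Hypergraph V) (v₀ : V) (r : ℤ) : Type _ :=
  Subquotient (cycles K H v₀ (r + 1).toNat)
    (LinearMap.range (boundary K H v₀ (r + 1).toNat))

/-- The binomial coefficient with an integer lower entry, zero when that entry is negative. -/
def binom (a : ℕ) (b : ℤ) : ℕ := if 0 ≤ b then a.choose b.toNat else 0

theorem merge_merge {p : ℕ} (i : Fin (p + 2)) (j : Fin (p + 3)) (h : (j : ℕ) ≤ i)
    (x : Fin (p + 3)) :
    merge i (merge j x) = merge (j.castLT (by omega)) (merge i.succ x) := by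
  apply Fin.ext
  have := x.isLt
  have := i.isLt
  have := j.isLt
  simp only [merge_val, Fin.val_succ, Fin.val_castLT]
  split_ifs <;> omega

theorem boundary_single (K : Type*) [Field K] {V : Type*} (H : Hypergraph V) (v₀ : V) (p : ℕ)
    (f : Face H v₀ (p + 1)) (a : K) :
    boundary K H v₀ p (Finsupp.single f a) =
      ∑ i : Fin (p + 2), Finsupp.single (mergeFace i f) ((-1 : K) ^ (i : ℕ) * a) := by
  simp [boundary]

/-- The boundary maps form a complex. -/
theorem boundary_boundary (K : Type*) [Field K] {V : Type*} (H : Hypergraph V) (v₀ : V) (p : ℕ) :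
    boundary K H v₀ p ∘ₗ boundary K H v₀ (p + 1) = 0 := by
  apply Finsupp.lhom_ext
  intro f a
  simp only [LinearMap.comp_apply, boundary_single, map_sum, LinearMap.zero_apply]
  rw [Finset.sum_comm, ← Finset.sum_product']
  let T : Finset (Fin (p + 2) × Fin (p + 3)) := {ij : Fin (p + 2) × Fin (p + 3) | (ij.2 : ℕ) ≤ (ij.1 : ℕ)}
  rw [Finset.univ_product_univ, ← Finset.sum_add_sum_compl T, ← eq_neg_iff_add_eq_zero,
    ← Finset.sum_neg_distrib]
  let φ : ∀ ij : Fin (p + 2) × Fin (p + 3), ij ∈ T → Fin (p + 2) × Fin (p + 3) := fun ij hij =>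
    (Fin.castLT ij.2 (lt_of_le_of_lt (Finset.mem_filter.mp hij).right (Fin.is_lt ij.1)), ij.1.succ)
  apply Finset.sum_bij φ
  · intro ij hij
    simp_rw [T, φ, Finset.compl_filter, Finset.mem_filter_univ, Fin.val_succ,
      Fin.val_castLT] at hij ⊢
    omega
  · rintro ⟨i, j⟩ hij ⟨i', j'⟩ hij' h
    simp only [φ, Prod.mk.injEq, Fin.ext_iff, Fin.val_castLT, Fin.val_succ] at h ⊢
    omega
  · rintro ⟨i', j'⟩ hij'
    have hj' := j'.isLt
    simp_rw [T, Finset.compl_filter, Finset.mem_filter_univ, not_le] at hij'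
    refine ⟨(⟨j' - 1, by omega⟩, Fin.castSucc i'), ?_, ?_⟩
    · simp only [T, Finset.mem_filter_univ, Fin.val_castSucc]
      omega
    · refine Prod.ext (Fin.ext rfl) (Fin.ext ?_)
      simp only [φ, Fin.val_succ]
      omega
  · rintro ⟨i, j⟩ hij
    have hij' : (j : ℕ) ≤ i := by simpa [T] using hij
    rw [← Finsupp.single_neg]
    congr 1
    · exact Subtype.ext (funext fun v => merge_merge i j hij' (f.1 v))
    · simp only [φ, Fin.val_succ, Fin.val_castLT, pow_succ]
      ring

/-- The chromatic polynomial counts the proper colorings: its value at every natural number `m` is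
the number of proper colorings with `m` colors. -/
theorem chromaticPolynomial_eval {W : Type*} [Finite W] (G : SimpleGraph W) (m : ℕ) :
    (chromaticPolynomial G).eval (m : ℚ) = (Nat.card (G.Coloring (Fin m)) : ℚ) := by
  classical
  have := Fintype.ofFinite W
  have hfin (α : Type) [Finite α] : Finite (G.Coloring α) := DFunLike.finite _
  -- colorings with image exactly `s`
  have hcard (s : Finset (Fin m)) :
      Nat.card {c : G.Coloring (Fin m) // Finset.univ.image c = s} =
        Nat.card {c : G.Coloring (Fin s.card) // Function.Surjective c} := by
    obtain e : s ≃ Fin s.card := s.equivFin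
    have hmem (c : {c : G.Coloring (Fin m) // Finset.univ.image c = s}) (w : W) : c.1 w ∈ s :=
      (Finset.ext_iff.mp c.2 _).mp (Finset.mem_image_of_mem _ (Finset.mem_univ w))
    refine Nat.card_congr
      { toFun := fun c => ⟨SimpleGraph.Coloring.mk
          (fun w => e ⟨c.1 w, hmem c w⟩) ?_, ?_⟩
        invFun := fun c => ⟨SimpleGraph.Coloring.mk (fun w => (e.symm (c.1 w) : Fin m)) ?_, ?_⟩
        left_inv := ?_
        right_inv := ?_ }
    · intro v w hvw h
      have := e.injective h
      simp only [Subtype.mk.injEq] at this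
      exact c.1.valid hvw this
    · intro b
      have hb := (Finset.ext_iff.mp c.2 _).mpr (e.symm b).2
      simp only [Finset.mem_image, Finset.mem_univ, true_and] at hb
      obtain ⟨w, hw⟩ := hb
      refine ⟨w, ?_⟩
      change e ⟨c.1 w, _⟩ = b
      rw [← e.apply_symm_apply b]
      congr 1
      exact Subtype.ext hw
    · intro v w hvw h
      exact c.1.valid hvw (e.symm.injective (Subtype.ext h))
    · ext b
      simp only [Finset.mem_image, Finset.mem_univ, true_and]
      constructor
      · rintro ⟨w, rfl⟩
        exact (e.symm (c.1 w)).2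
      · intro hb
        obtain ⟨w, hw⟩ := c.2 (e ⟨b, hb⟩)
        refine ⟨w, ?_⟩
        change ((e.symm (c.1 w) : s) : Fin m) = b
        rw [hw, e.symm_apply_apply]
    · intro c
      apply Subtype.ext
      apply DFunLike.ext
      intro w
      change ((e.symm (e _) : s) : Fin m) = _
      rw [e.symm_apply_apply]
    · intro c
      apply Subtype.ext
      apply DFunLike.ext
      intro w
      exact e.apply_symm_apply (c.1 w)
  have hsum : Nat.card (G.Coloring (Fin m)) =
      ∑ s : Finset (Fin m), Nat.card {c : G.Coloring (Fin s.card) // Function.Surjective c} := by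
    rw [← Nat.card_congr (Equiv.sigmaFiberEquiv
      (fun c : G.Coloring (Fin m) => (Finset.univ.image c : Finset (Fin m)))), Nat.card_sigma]
    exact Finset.sum_congr rfl fun s _ => hcard s
  have hzero (j : ℕ) (hj : Nat.card W < j) :
      Nat.card {c : G.Coloring (Fin j) // Function.Surjective c} = 0 := by
    have : IsEmpty {c : G.Coloring (Fin j) // Function.Surjective c} := ⟨fun c => by
      have := Nat.card_le_card_of_surjective _ c.2
      simp only [Nat.card_fin] at this
      omega⟩
    exact Nat.card_of_isEmpty
  have hsum2 : Nat.card (G.Coloring (Fin m)) = ∑ j ∈ Finset.range (m + 1),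
      m.choose j * Nat.card {c : G.Coloring (Fin j) // Function.Surjective c} := by
    rw [hsum, ← Finset.powerset_univ, Finset.sum_powerset_apply_card
      (fun j => Nat.card {c : G.Coloring (Fin j) // Function.Surjective c})]
    simp
  rw [hsum2]
  simp only [chromaticPolynomial, eval_finsetSum, eval_mul, eval_C,
    descPochhammer_eval_eq_descFactorial, Nat.descFactorial_eq_factorial_mul_choose]
  push_cast
  have hterm (j : ℕ) : (Nat.card {c : G.Coloring (Fin j) // Function.Surjective c} : ℚ) /
      (j.factorial : ℚ) * ((j.factorial : ℚ) * (m.choose j : ℚ)) =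
      (m.choose j : ℚ) * Nat.card {c : G.Coloring (Fin j) // Function.Surjective c} := by
    have : (j.factorial : ℚ) ≠ 0 := by exact_mod_cast j.factorial_ne_zero
    field_simp
  simp only [hterm]
  rcases le_total (Nat.card W) m with h | h
  · refine Finset.sum_subset (Finset.range_mono (by omega)) fun j _ hj => ?_
    rw [hzero j (by simpa using hj)]
    simp
  · refine (Finset.sum_subset (Finset.range_mono (by omega)) fun j _ hj => ?_).symm
    rw [Nat.choose_eq_zero_of_lt (by simpa using hj)]
    simp

end

end CyclicColoring

/-! Homology does not depend on the distinguished vertex, so that vertex may be moved to a vertex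
`v₁` of the core, which lies in every hyperedge. Then the block containing a hyperedge must be block
`0`, and a face is an ordered partition whose support `U`, the complement of block `0`, avoids some
hyperedge. These sets `U` are closed under taking subsets.

Read the blocks as positions on a circle with block `0` at the base point. A face with blocks `0, …,
p` is then the open simplex `0 < t₁ < ⋯ < t_p < 1` in a torus with one coordinate per vertex other
than `v₁`, and the boundary is the simplicial one. The complex is thus that of a union of coordinate
subtori, one for each avoiding set `U`. Its homology should have the fundamental classes of these
subtori as a basis, so that with `p = r + 1` its dimension is the number of avoiding sets of size
`p`.

Algebraically, merges not involving block `0` preserve `U` and the other two shrink it. For fixed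
`U` the complex of ordered partitions of `U` is that of a sphere, with homology only in degree `#U`,
detected by one coefficient (`cells_acyclic`). Stripping off maximal supports one at a time shows
that a cycle killed by all the functionals `cocycle K U` is a boundary
(`exists_bd_eq_of_cocycle_eq_zero`). These functionals vanish on boundaries (`cocycle_bd`) and are
dual to the alternating cycles `torusClass`, which gives `finrank_homology_of_mem_edges`.

For a star with core `S` and leaf set `M`, the avoiding sets are the subsets of the complement of
`S` that do not contain `M`, where `#M = l - k + 1`. This gives `C(n-k+1, p) - C(n-l, p-#M)`. The
contracted graph is a star with isolated vertices, so its chromatic polynomial is `X^(n-l+1)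
(X-1)^#M` and `D = 1`. The stated formulas follow by Pascal's rule and symmetry of binomial
coefficients. -/

namespace CyclicColoring

/-! ### Ordered partitions with fixed support, and the homotopy splitting off a vertex -/

section Inner

variable {K : Type*} [Field K] {V : Type*}

/-- All chain groups are realized inside the single space `(V → ℕ) →₀ K` and distinguished by
supports only. This reduction to basis elements replaces extensionality on each chain group. -/
theorem map_mem_of_supported {α M : Type*} [AddCommGroup M] [Module K M] {s : Set α}
    (L : (α →₀ K) →ₗ[K] M) (N : Submodule K M) (h : ∀ a ∈ s, L (Finsupp.single a 1) ∈ N)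
    {z : α →₀ K} (hz : z ∈ Finsupp.supported K K s) : L z ∈ N := by
  rw [Finsupp.supported_eq_span_single] at hz
  have : Submodule.span K ((fun i => Finsupp.single i (1 : K)) '' s) ≤ N.comap L := by
    rw [Submodule.span_le]
    rintro _ ⟨a, ha, rfl⟩
    exact h a ha
  exact this hz

theorem map_eq_of_supported {α M : Type*} [AddCommGroup M] [Module K M] {s : Set α}
    (L L' : (α →₀ K) →ₗ[K] M) (h : ∀ a ∈ s, L (Finsupp.single a 1) = L' (Finsupp.single a 1))
    {z : α →₀ K} (hz : z ∈ Finsupp.supported K K s) : L z = L' z := by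
  have := map_mem_of_supported (L - L') ⊥ (fun a ha => by simp [h a ha]) hz
  simpa [sub_eq_zero] using this

/-- The usual argument for `∂∂ = 0`: the pairs `(i, j)` with `j ≤ i` cancel against `(j, i + 1)`. In
the induction the new row `i = n` cancels the new column `j = n + 1`. -/
theorem sum_alternating_faces_eq_zero {M : Type*} [AddCommGroup M] [Module K M] (n : ℕ)
    (a : ℕ → ℕ → M) (h : ∀ i j, j ≤ i → i < n → a i j = a j (i + 1)) :
    ∑ i ∈ Finset.range n, ∑ j ∈ Finset.range (n + 1), (-1 : K) ^ (i + j) • a i j = 0 := by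
  induction n with
  | zero => simp
  | succ n ih =>
    rw [Finset.sum_range_succ]
    have h1 : ∀ i, ∑ j ∈ Finset.range (n + 1 + 1), (-1 : K) ^ (i + j) • a i j =
        ∑ j ∈ Finset.range (n + 1), (-1 : K) ^ (i + j) • a i j +
          (-1 : K) ^ (i + (n + 1)) • a i (n + 1) := fun i => Finset.sum_range_succ _ _
    simp only [h1]
    rw [Finset.sum_add_distrib, ih fun i j hj hi => h i j hj (by omega), zero_add,
      add_left_comm, ← Finset.sum_range_succ (fun i => (-1 : K) ^ (i + (n + 1)) • a i (n + 1)),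
      ← Finset.sum_add_distrib]
    refine Finset.sum_eq_zero fun j hj => ?_
    rw [h n j (by simpa [Nat.lt_succ_iff] using hj) (by omega), ← add_smul]
    convert zero_smul K _
    ring

/-- The effect on block indices of merging the blocks `i` and `i + 1`. -/
def collapse (i x : ℕ) : ℕ := if x ≤ i then x else x - 1

/-- The linear extension of relabeling the blocks by `g`. -/
noncomputable def relabel (K : Type*) [Field K] (V : Type*) (g : ℕ → ℕ) :
    ((V → ℕ) →₀ K) →ₗ[K] ((V → ℕ) →₀ K) :=
  Finsupp.lmapDomain K K fun f => g ∘ f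

@[simp]
theorem relabel_single (g : ℕ → ℕ) (f : V → ℕ) (a : K) :
    relabel K V g (Finsupp.single f a) = Finsupp.single (g ∘ f) a := by
  simp [relabel]

theorem relabel_relabel (g g' : ℕ → ℕ) (z : (V → ℕ) →₀ K) :
    relabel K V g (relabel K V g' z) = relabel K V (g ∘ g') z := by
  simp only [relabel, Finsupp.lmapDomain_apply, ← Finsupp.mapDomain_comp]
  rfl

/-- The part of the boundary that merges no block with the block `0`. -/
noncomputable def inner (K : Type*) [Field K] (V : Type*) (p : ℕ) :
    ((V → ℕ) →₀ K) →ₗ[K] ((V → ℕ) →₀ K) :=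
  ∑ i ∈ Finset.Ico 1 p, (-1 : K) ^ i • relabel K V (collapse i)

theorem inner_single (p : ℕ) (f : V → ℕ) :
    inner K V p (Finsupp.single f 1) =
      ∑ i ∈ Finset.Ico 1 p, (-1 : K) ^ i • Finsupp.single (collapse i ∘ f) 1 := by
  simp [inner, LinearMap.sum_apply]

theorem collapse_comp_collapse {i j : ℕ} (h : j ≤ i) :
    collapse i ∘ collapse j = collapse j ∘ collapse (i + 1) := by
  funext x
  simp only [collapse, Function.comp_apply]
  split_ifs <;> omega

theorem inner_inner (p : ℕ) (z : (V → ℕ) →₀ K) : inner K V p (inner K V (p + 1) z) = 0 := by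
  rcases p with _ | p
  · simp [inner]
  have := sum_alternating_faces_eq_zero (K := K) p
    (fun i j => relabel K V (collapse (1 + i) ∘ collapse (1 + j)) z) (fun i j hj _ => by
      rw [collapse_comp_collapse (by omega), add_assoc])
  simp only [inner, LinearMap.sum_apply, LinearMap.smul_apply, map_sum, map_smul,
    relabel_relabel, Finset.sum_Ico_eq_sum_range]
  rw [← this, Finset.sum_comm]
  refine Finset.sum_congr (by simp) fun i _ => ?_
  rw [Finset.smul_sum]
  refine Finset.sum_congr (by simp) fun j _ => ?_
  rw [smul_smul]
  congr 1
  ring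

/-- The ordered partitions with blocks `0, …, p`, where `U` is the complement of the block `0`. -/
def cells (U : Finset V) (p : ℕ) : Set (V → ℕ) :=
  {f | (∀ v, v ∈ U ↔ f v ≠ 0) ∧ (∀ v, f v ≤ p) ∧ ∀ j, 1 ≤ j → j ≤ p → ∃ v, f v = j}

theorem collapse_mem_cells {U : Finset V} {p i : ℕ} {f : V → ℕ} (hf : f ∈ cells U (p + 1))
    (h1 : 1 ≤ i) (h2 : i ≤ p) : collapse i ∘ f ∈ cells U p := by
  obtain ⟨a, b, c⟩ := hf
  refine ⟨fun v => ?_, fun v => ?_, fun j hj hjp => ?_⟩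
  · rw [a, Function.comp_apply, collapse]; split_ifs <;> omega
  · have := b v
    rw [Function.comp_apply, collapse]; split_ifs <;> omega
  · by_cases hji : j ≤ i
    · obtain ⟨v, hv⟩ := c j hj (by omega)
      exact ⟨v, by simp [collapse, hv, hji]⟩
    · obtain ⟨v, hv⟩ := c (j + 1) (by omega) (by omega)
      exact ⟨v, by rw [Function.comp_apply, collapse, hv, if_neg (by omega)]; omega⟩

theorem inner_mem_supported {U : Finset V} {p : ℕ} {z : (V → ℕ) →₀ K}
    (hz : z ∈ Finsupp.supported K K (cells U (p + 1))) :
    inner K V (p + 1) z ∈ Finsupp.supported K K (cells U p) := by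
  refine map_mem_of_supported _ _ (fun f hf => ?_) hz
  rw [inner_single]
  refine Submodule.sum_mem _ fun i hi => Submodule.smul_mem _ _ ?_
  rw [Finset.mem_Ico] at hi
  exact Finsupp.single_mem_supported K _ (collapse_mem_cells hf hi.1 (by omega))

open Classical in
/-- Make `u` a block of its own, in front of the rest of its block. -/
noncomputable def splitOff (u : V) (f : V → ℕ) : V → ℕ :=
  fun v => if v = u ∨ f v < f u then f v else f v + 1

theorem splitOff_self (u : V) (f : V → ℕ) : splitOff u f u = f u := by simp [splitOff]

theorem splitOff_mem_cells {U : Finset V} {p : ℕ} {u : V} {f : V → ℕ} (hu : u ∈ U)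
    (hf : f ∈ cells U p) (h : ∃ v, v ≠ u ∧ f v = f u) : splitOff u f ∈ cells U (p + 1) := by
  obtain ⟨a, b, c⟩ := hf
  have hu0 := (a u).1 hu
  refine ⟨fun v => ?_, fun v => ?_, fun j hj hjp => ?_⟩
  · rw [a, splitOff]
    split_ifs with h' <;> simp
    push Not at h'
    omega
  · have := b v
    rw [splitOff]; split_ifs <;> omega
  · rcases lt_trichotomy j (f u) with hlt | rfl | hlt
    · obtain ⟨v, hv⟩ := c j hj (by have := b u; omega)
      exact ⟨v, by simp [splitOff, hv, hlt]⟩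
    · exact ⟨u, splitOff_self u f⟩
    · have hv : ∃ v, v ≠ u ∧ f v = j - 1 := by
        by_cases hj' : j = f u + 1
        · subst hj'; simpa using h
        · obtain ⟨v, hv⟩ := c (j - 1) (by omega) (by omega)
          exact ⟨v, by rintro rfl; omega, hv⟩
      obtain ⟨v, hvu, hv⟩ := hv
      refine ⟨v, ?_⟩
      rw [splitOff, if_neg (by push Not; exact ⟨hvu, by omega⟩)]
      omega

theorem collapse_comp_splitOff (u : V) (f : V → ℕ) : collapse (f u) ∘ splitOff u f = f := by
  funext v
  by_cases hv : v = u
  · subst hv; simp [collapse, splitOff]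
  · simp only [Function.comp_apply, collapse, splitOff, hv, false_or]
    split_ifs <;> omega

theorem splitOff_collapse {u : V} {f : V → ℕ} {i : ℕ} (hi : f u ≤ i) :
    splitOff u (collapse i ∘ f) = collapse (i + 1) ∘ splitOff u f := by
  funext v
  by_cases hv : v = u
  · subst hv
    simp only [Function.comp_apply, splitOff_self, collapse]
    split_ifs <;> omega
  · simp only [Function.comp_apply, splitOff, collapse, hv, false_or]
    split_ifs <;> omega

theorem splitOff_collapse_self {u : V} {f : V → ℕ} (h : ∀ v, v ≠ u → f v ≠ f u) :
    splitOff u (collapse (f u) ∘ f) = f := by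
  funext v
  by_cases hv : v = u
  · subst hv
    simp [splitOff_self, collapse]
  · have := h v hv
    simp only [Function.comp_apply, splitOff, collapse, hv, false_or]
    split_ifs <;> omega

open Classical in
/-- The homotopy that splits off `u`. -/
noncomputable def splitHomotopy (K : Type*) [Field K] (u : V) :
    ((V → ℕ) →₀ K) →ₗ[K] ((V → ℕ) →₀ K) :=
  Finsupp.linearCombination K fun f =>
    if ∃ v, v ≠ u ∧ f v = f u then (-1 : K) ^ f u • Finsupp.single (splitOff u f) 1 else 0

theorem splitHomotopy_single_of_exists {u : V} {f : V → ℕ} (h : ∃ v, v ≠ u ∧ f v = f u) :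
    splitHomotopy K u (Finsupp.single f 1) =
      (-1 : K) ^ f u • Finsupp.single (splitOff u f) 1 := by
  rw [splitHomotopy, Finsupp.linearCombination_single, one_smul, if_pos h]

theorem splitHomotopy_single_of_not_exists {u : V} {f : V → ℕ}
    (h : ¬ ∃ v, v ≠ u ∧ f v = f u) : splitHomotopy K u (Finsupp.single f 1) = 0 := by
  rw [splitHomotopy, Finsupp.linearCombination_single, one_smul, if_neg h]

theorem splitHomotopy_mem_supported {U : Finset V} {p : ℕ} {u : V} (hu : u ∈ U)
    {z : (V → ℕ) →₀ K} (hz : z ∈ Finsupp.supported K K (cells U p)) :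
    splitHomotopy K u z ∈ Finsupp.supported K K (cells U (p + 1)) := by
  refine map_mem_of_supported _ _ (fun f hf => ?_) hz
  by_cases h : ∃ v, v ≠ u ∧ f v = f u
  · rw [splitHomotopy_single_of_exists h]
    exact Submodule.smul_mem _ _ (Finsupp.single_mem_supported K _ (splitOff_mem_cells hu hf h))
  · rw [splitHomotopy_single_of_not_exists h]
    exact Submodule.zero_mem _

/-- The cells in which `u` does not form the last block and has index less than `J`. -/
def lowCells (U : Finset V) (p : ℕ) (u : V) (J : ℕ) : Set (V → ℕ) :=
  {f | f ∈ cells U p ∧ (∃ v, v ≠ u ∧ f u ≤ f v) ∧ f u < J}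

theorem splitHomotopy_collapse_mem {U : Finset V} {p i : ℕ} {u : V} {f : V → ℕ} (hu : u ∈ U)
    (hf : f ∈ cells U p) (h1 : 1 ≤ i) (h2 : i < f u) :
    splitHomotopy K u (Finsupp.single (collapse i ∘ f) 1) ∈
      Finsupp.supported K K (lowCells U p u (f u)) := by
  by_cases h : ∃ v, v ≠ u ∧ (collapse i ∘ f) v = (collapse i ∘ f) u
  · rw [splitHomotopy_single_of_exists h]
    refine Submodule.smul_mem _ _ (Finsupp.single_mem_supported K _ ⟨?_, ?_, ?_⟩)
    · have := hf.2.1 u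
      obtain ⟨q, rfl⟩ : ∃ q, p = q + 1 := ⟨p - 1, by omega⟩
      exact splitOff_mem_cells hu (collapse_mem_cells hf h1 (by omega)) h
    · obtain ⟨v, hv, hvu⟩ := h
      refine ⟨v, hv, ?_⟩
      rw [splitOff_self, splitOff, if_neg (by push Not; exact ⟨hv, hvu.ge⟩), hvu]
      omega
    · rw [splitOff_self, Function.comp_apply, collapse, if_neg (by omega)]
      omega
  · rw [splitHomotopy_single_of_not_exists h]
    exact Submodule.zero_mem _

/-- The splitting operator is a contracting homotopy up to cells in which `u` has smaller index. If
`u` shares its block, the merge at `f u` undoes the split and returns `f`, and the later merges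
cancel in pairs. If `u` is alone, merging it with the next block and splitting again returns `f`. In
both cases merges before position `f u` lower the index of `u`. -/
theorem splitHomotopy_spec {U : Finset V} {p : ℕ} {u : V} (hu : u ∈ U) {f : V → ℕ}
    (hf : f ∈ cells U p) (hlast : ∃ v, v ≠ u ∧ f u ≤ f v) :
    inner K V (p + 1) (splitHomotopy K u (Finsupp.single f 1)) +
        splitHomotopy K u (inner K V p (Finsupp.single f 1)) - Finsupp.single f 1 ∈
      Finsupp.supported K K (lowCells U p u (f u)) := by
  have hj1 : 1 ≤ f u := Nat.one_le_iff_ne_zero.2 ((hf.1 u).1 hu)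
  have hjp : f u ≤ p := hf.2.1 u
  have hB1 : ∑ i ∈ Finset.Ico 1 (f u), (-1 : K) ^ i •
      splitHomotopy K u (Finsupp.single (collapse i ∘ f) 1) ∈
        Finsupp.supported K K (lowCells U p u (f u)) := by
    refine Submodule.sum_mem _ fun i hi => Submodule.smul_mem _ _ ?_
    rw [Finset.mem_Ico] at hi
    exact splitHomotopy_collapse_mem hu hf hi.1 hi.2
  have hsq : (-1 : K) ^ f u * (-1) ^ f u = 1 := by rw [← mul_pow]; simp
  rw [inner_single, map_sum]
  simp only [map_smul]
  by_cases h : ∃ v, v ≠ u ∧ f v = f u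
  · rw [splitHomotopy_single_of_exists h, map_smul, inner_single,
      ← Finset.sum_Ico_consecutive _ hj1 (by omega : f u ≤ p + 1),
      ← Finset.sum_Ico_consecutive _ hj1 hjp, Finset.sum_eq_sum_Ico_succ_bot (by omega : f u < p + 1),
      collapse_comp_splitOff]
    have hA1 : ∑ i ∈ Finset.Ico 1 (f u), (-1 : K) ^ i •
        Finsupp.single (collapse i ∘ splitOff u f) (1 : K) ∈
          Finsupp.supported K K (lowCells U p u (f u)) := by
      refine Submodule.sum_mem _ fun i hi => Submodule.smul_mem _ _ ?_
      rw [Finset.mem_Ico] at hi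
      refine Finsupp.single_mem_supported K _ ⟨collapse_mem_cells (splitOff_mem_cells hu hf h)
        hi.1 (by omega), ?_, ?_⟩
      · obtain ⟨v, hv, hvu⟩ := h
        refine ⟨v, hv, ?_⟩
        have hv' : splitOff u f v = f u + 1 := by simp [splitOff, hv, hvu]
        simp only [Function.comp_apply, splitOff_self, hv', collapse]
        split_ifs <;> omega
      · rw [Function.comp_apply, splitOff_self, collapse, if_neg (by omega)]
        omega
    -- Splitting after the merge at `i` equals the merge at `i + 1` after splitting. The index shift
    -- supplies the opposite sign.
    have hB2 : ∑ i ∈ Finset.Ico (f u) p, (-1 : K) ^ i •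
        splitHomotopy K u (Finsupp.single (collapse i ∘ f) 1) =
        -((-1 : K) ^ f u • ∑ i ∈ Finset.Ico (f u + 1) (p + 1), (-1 : K) ^ i •
          Finsupp.single (collapse i ∘ splitOff u f) (1 : K)) := by
      rw [← Finset.sum_Ico_add', Finset.smul_sum, ← Finset.sum_neg_distrib]
      refine Finset.sum_congr rfl fun i hi => ?_
      rw [Finset.mem_Ico] at hi
      have hcu : (collapse i ∘ f) u = f u := by simp [collapse, hi.1]
      rw [splitHomotopy_single_of_exists (by
        obtain ⟨v, hv, hvu⟩ := h
        exact ⟨v, hv, by simp [hvu]⟩), hcu, splitOff_collapse hi.1, smul_smul, smul_smul, ← neg_smul]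
      congr 1
      ring
    rw [hB2]
    have := Submodule.add_mem _ (Submodule.smul_mem _ ((-1 : K) ^ f u) hA1) hB1
    convert this using 1
    simp only [smul_add, smul_smul, hsq, one_smul]
    abel
  -- Here `{u}` is a block but not the last one, so there is a next block to merge with.
  · have hjp' : f u < p := by
      obtain ⟨v, hv, hvu⟩ := hlast
      have h1 := hf.2.1 v
      have h2 : f v ≠ f u := fun h' => h ⟨v, hv, h'⟩
      omega
    rw [splitHomotopy_single_of_not_exists h, map_zero, zero_add,
      ← Finset.sum_Ico_consecutive _ hj1 hjp, Finset.sum_eq_sum_Ico_succ_bot hjp']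
    have hmid : (-1 : K) ^ f u • splitHomotopy K u (Finsupp.single (collapse (f u) ∘ f) 1) =
        Finsupp.single f 1 := by
      have hcu : (collapse (f u) ∘ f) u = f u := by simp [collapse]
      rw [splitHomotopy_single_of_exists, hcu, splitOff_collapse_self fun v hv h' => h ⟨v, hv, h'⟩,
        smul_smul, hsq, one_smul]
      obtain ⟨v, hv⟩ := hf.2.2 (f u + 1) (by omega) hjp'
      exact ⟨v, by rintro rfl; omega, by simp [hv, collapse]⟩
    have hB3 : ∑ i ∈ Finset.Ico (f u + 1) p, (-1 : K) ^ i •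
        splitHomotopy K u (Finsupp.single (collapse i ∘ f) 1) = 0 := by
      refine Finset.sum_eq_zero fun i hi => ?_
      rw [Finset.mem_Ico] at hi
      rw [splitHomotopy_single_of_not_exists, smul_zero]
      rintro ⟨v, hv, h'⟩
      refine h ⟨v, hv, ?_⟩
      simp only [Function.comp_apply, collapse] at h'
      split_ifs at h' <;> omega
    rw [hmid, hB3]
    simpa using hB1

/-- The error term of the homotopy is again a cycle, and the index of `u` in it is strictly smaller.
Induction on the bound `J` removes it. -/
theorem lowCells_acyclic {U : Finset V} {p : ℕ} {u : V} (hu : u ∈ U) (J : ℕ) {z : (V → ℕ) →₀ K}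
    (hz : z ∈ Finsupp.supported K K (lowCells U p u J)) (hcyc : inner K V p z = 0) :
    ∃ y ∈ Finsupp.supported K K (cells U (p + 1)), inner K V (p + 1) y = z := by
  induction J generalizing z with
  | zero =>
    have : lowCells U p u 0 = ∅ := by ext; simp [lowCells]
    rw [this, Finsupp.supported_empty, Submodule.mem_bot] at hz
    exact ⟨0, Submodule.zero_mem _, by simp [hz]⟩
  | succ J ih =>
    have hcell : z ∈ Finsupp.supported K K (cells U p) :=
      Finsupp.supported_mono (fun f hf => hf.1) hz
    have key : (inner K V (p + 1) ∘ₗ splitHomotopy K u +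
        splitHomotopy K u ∘ₗ inner K V p - LinearMap.id : ((V → ℕ) →₀ K) →ₗ[K] _) z ∈
          Finsupp.supported K K (lowCells U p u J) := by
      refine map_mem_of_supported _ _ (fun f hf => ?_) hz
      refine Finsupp.supported_mono (fun f' hf' => ?_) (splitHomotopy_spec hu hf.1 hf.2.1)
      exact ⟨hf'.1, hf'.2.1, by have := hf.2.2; have := hf'.2.2; omega⟩
    simp only [LinearMap.sub_apply, LinearMap.add_apply, LinearMap.comp_apply, LinearMap.id_apply,
      hcyc, map_zero, add_zero] at key
    obtain ⟨y, hy, hyz⟩ := ih key (by rw [map_sub, inner_inner, hcyc, sub_zero])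
    exact ⟨splitHomotopy K u z - y, Submodule.sub_mem _ (splitHomotopy_mem_supported hu hcell) hy,
      by rw [map_sub, hyz]; abel⟩

end Inner

/-! ### Deleting a vertex that forms the last block -/

section DropLast

variable {K : Type*} [Field K] {V : Type*} [DecidableEq V]

open Classical in
/-- Delete `u` from those cells whose last block is `{u}`, and kill the others. -/
noncomputable def dropLast (K : Type*) [Field K] (u : V) :
    ((V → ℕ) →₀ K) →ₗ[K] ((V → ℕ) →₀ K) :=
  Finsupp.linearCombination K fun f =>
    if ∀ v, v ≠ u → f v < f u then Finsupp.single (Function.update f u 0) 1 else 0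

theorem dropLast_single_of_forall {u : V} {f : V → ℕ} (h : ∀ v, v ≠ u → f v < f u) :
    dropLast K u (Finsupp.single f 1) = Finsupp.single (Function.update f u 0) 1 := by
  rw [dropLast, Finsupp.linearCombination_single, one_smul, if_pos h]

theorem dropLast_single_of_not_forall {u : V} {f : V → ℕ} (h : ¬ ∀ v, v ≠ u → f v < f u) :
    dropLast K u (Finsupp.single f 1) = 0 := by
  rw [dropLast, Finsupp.linearCombination_single, one_smul, if_neg h]

theorem apply_eq_of_forall_lt {U : Finset V} {p : ℕ} {u : V} (hu : u ∈ U) {f : V → ℕ}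
    (hf : f ∈ cells U p) (h : ∀ v, v ≠ u → f v < f u) : f u = p := by
  have h1 := (hf.1 u).1 hu
  have h2 := hf.2.1 u
  obtain ⟨v, hv⟩ := hf.2.2 p (by omega) le_rfl
  by_cases hvu : v = u
  · exact hvu ▸ hv
  · have := h v hvu
    omega

theorem update_zero_mem_cells {U : Finset V} {p : ℕ} {u : V} (hu : u ∈ U) {f : V → ℕ}
    (hf : f ∈ cells U (p + 1)) (h : ∀ v, v ≠ u → f v < f u) :
    Function.update f u 0 ∈ cells (U.erase u) p := by
  have hfu := apply_eq_of_forall_lt hu hf h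
  refine ⟨fun v => ?_, fun v => ?_, fun j hj hjp => ?_⟩
  · by_cases hv : v = u
    · simp [hv]
    · simp [hv, hf.1 v]
  · by_cases hv : v = u
    · simp [hv]
    · have := h v hv
      simp only [Function.update_of_ne hv]
      omega
  · obtain ⟨v, hv⟩ := hf.2.2 j hj (by omega)
    refine ⟨v, ?_⟩
    rw [Function.update_of_ne (by rintro rfl; omega), hv]

theorem update_last_mem_cells {U : Finset V} {p : ℕ} {u : V} (hu : u ∈ U) {f : V → ℕ}
    (hf : f ∈ cells (U.erase u) p) : Function.update f u (p + 1) ∈ cells U (p + 1) := by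
  refine ⟨fun v => ?_, fun v => ?_, fun j hj hjp => ?_⟩
  · by_cases hv : v = u
    · simp [hv, hu]
    · have := hf.1 v
      simp only [Finset.mem_erase, hv, ne_eq, not_false_eq_true, true_and] at this
      simp [hv, this]
  · by_cases hv : v = u
    · simp [hv]
    · have := hf.2.1 v
      simp only [Function.update_of_ne hv]
      omega
  · by_cases hjp' : j = p + 1
    · exact ⟨u, by simp [hjp']⟩
    · obtain ⟨v, hv⟩ := hf.2.2 j hj (by omega)
      refine ⟨v, ?_⟩
      have := hf.1 u
      rw [Function.update_of_ne, hv]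
      rintro rfl
      simp at this
      omega

theorem dropLast_update_last {U : Finset V} {p : ℕ} {u : V} {f : V → ℕ}
    (hf : f ∈ cells (U.erase u) p) :
    dropLast K u (Finsupp.single (Function.update f u (p + 1)) 1) = Finsupp.single f 1 := by
  rw [dropLast_single_of_forall, Function.update_idem, Function.update_eq_self_iff.2]
  · by_contra h
    have := (hf.1 u).2 (Ne.symm h)
    simp at this
  · intro v hv
    have := hf.2.1 v
    simp only [Function.update_of_ne hv, Function.update_self]
    omega

theorem dropLast_mem_supported {U : Finset V} {p : ℕ} {u : V} (hu : u ∈ U) {z : (V → ℕ) →₀ K}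
    (hz : z ∈ Finsupp.supported K K (cells U (p + 1))) :
    dropLast K u z ∈ Finsupp.supported K K (cells (U.erase u) p) := by
  refine map_mem_of_supported _ _ (fun f hf => ?_) hz
  by_cases h : ∀ v, v ≠ u → f v < f u
  · rw [dropLast_single_of_forall h]
    exact Finsupp.single_mem_supported K _ (update_zero_mem_cells hu hf h)
  · rw [dropLast_single_of_not_forall h]
    exact Submodule.zero_mem _

/-- Since the deleted block is the last one, the remaining merges keep their positions and signs.
This makes `dropLast` a chain map onto the complex of `U.erase u`, shifted by one degree. -/
theorem dropLast_inner {U : Finset V} {p : ℕ} {u : V} (hu : u ∈ U) {z : (V → ℕ) →₀ K}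
    (hz : z ∈ Finsupp.supported K K (cells U (p + 1))) :
    dropLast K u (inner K V (p + 1) z) = inner K V p (dropLast K u z) := by
  refine map_eq_of_supported (dropLast K u ∘ₗ inner K V (p + 1)) (inner K V p ∘ₗ dropLast K u)
    (fun f hf => ?_) hz
  simp only [LinearMap.comp_apply]
  rw [inner_single, map_sum]
  simp only [map_smul]
  by_cases h : ∀ v, v ≠ u → f v < f u
  · have hfu := apply_eq_of_forall_lt hu hf h
    rw [dropLast_single_of_forall h, inner_single]
    rcases p with _ | p
    · simp
    -- The last merge joins `{u}` to its predecessor, so `dropLast` kills it.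
    rw [Finset.sum_Ico_succ_top (by omega), dropLast_single_of_not_forall, smul_zero, add_zero]
    · refine Finset.sum_congr rfl fun i hi => ?_
      rw [Finset.mem_Ico] at hi
      rw [dropLast_single_of_forall]
      · congr 2
        funext v
        by_cases hv : v = u
        · subst hv
          simp [collapse]
        · simp [hv]
      · intro v hv
        have := h v hv
        simp only [Function.comp_apply, collapse]
        split_ifs <;> omega
    · push Not
      obtain ⟨v, hv⟩ := hf.2.2 (p + 1) (by omega) (by omega)
      refine ⟨v, by rintro rfl; omega, ?_⟩
      simp [collapse, hv, hfu]
  · rw [dropLast_single_of_not_forall h, map_zero]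
    refine Finset.sum_eq_zero fun i hi => ?_
    rw [dropLast_single_of_not_forall, smul_zero]
    push Not at h ⊢
    obtain ⟨v, hv, hvu⟩ := h
    refine ⟨v, hv, ?_⟩
    simp only [Function.comp_apply, collapse]
    split_ifs <;> omega

/-- Subtracting the chain obtained by deleting `u` and appending it again removes exactly the cells
ending in `{u}`. On the kernel of `dropLast` nothing is subtracted. -/
theorem mem_lowCells_of_dropLast_eq_zero {U : Finset V} {p : ℕ} {u : V} (hu : u ∈ U)
    {z : (V → ℕ) →₀ K} (hz : z ∈ Finsupp.supported K K (cells U p))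
    (hd : dropLast K u z = 0) : z ∈ Finsupp.supported K K (lowCells U p u (p + 1)) := by
  have key : (LinearMap.id - Finsupp.lmapDomain K K (fun f => Function.update f u p) ∘ₗ
      dropLast K u : ((V → ℕ) →₀ K) →ₗ[K] _) z ∈
        Finsupp.supported K K (lowCells U p u (p + 1)) := by
    refine map_mem_of_supported _ _ (fun f hf => ?_) hz
    simp only [LinearMap.sub_apply, LinearMap.id_apply, LinearMap.comp_apply]
    by_cases h : ∀ v, v ≠ u → f v < f u
    · have hfu := apply_eq_of_forall_lt hu hf h
      rw [dropLast_single_of_forall h, Finsupp.lmapDomain_apply, Finsupp.mapDomain_single,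
        Function.update_idem, ← hfu, Function.update_eq_self, sub_self]
      exact Submodule.zero_mem _
    · rw [dropLast_single_of_not_forall h, map_zero, sub_zero]
      push Not at h
      exact Finsupp.single_mem_supported K _ ⟨hf, h, Nat.lt_succ_of_le (hf.2.1 u)⟩
  simpa [hd] using key

end DropLast

/-! ### Homology of the ordered partitions of a fixed set -/

section Rank

variable {K : Type*} [Field K] {V : Type*} [LinearOrder V]

/-- The cell whose blocks, after the block `0`, are the elements of `U` in increasing order. -/
def rank (U : Finset V) (v : V) : ℕ := if v ∈ U then (U.filter (· ≤ v)).card else 0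

theorem rank_ne_zero_iff {U : Finset V} {v : V} : rank U v ≠ 0 ↔ v ∈ U := by
  rw [rank]
  split_ifs with h
  · simp only [ne_eq, Finset.card_eq_zero, h, iff_true]
    exact Finset.ne_empty_of_mem (a := v) (by simp [h])
  · simp [h]

theorem rank_le_card (U : Finset V) (v : V) : rank U v ≤ U.card := by
  rw [rank]
  split_ifs
  · exact Finset.card_filter_le _ _
  · omega

theorem rank_of_forall_le {U : Finset V} {u : V} (hu : u ∈ U) (hmax : ∀ v ∈ U, v ≤ u) :
    rank U u = U.card := by
  rw [rank, if_pos hu, Finset.filter_true_of_mem hmax]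

theorem rank_erase {U : Finset V} {u : V} (hmax : ∀ v ∈ U, v ≤ u) :
    rank (U.erase u) = Function.update (rank U) u 0 := by
  funext v
  by_cases hv : v = u
  · subst hv; simp [rank]
  · simp only [rank, Finset.mem_erase, hv, ne_eq, not_false_eq_true, true_and,
      Function.update_of_ne]
    split_ifs with h
    · congr 1
      ext w
      simp only [Finset.mem_filter, Finset.mem_erase]
      constructor
      · tauto
      · rintro ⟨hw, hwv⟩
        refine ⟨⟨?_, hw⟩, hwv⟩
        rintro rfl
        exact hv (le_antisymm (hmax v h) hwv)
    · rfl

theorem rank_injOn (U : Finset V) : Set.InjOn (rank U) U := by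
  have key : ∀ v ∈ U, ∀ w ∈ U, v < w → rank U v < rank U w := by
    intro v hv w hw hvw
    rw [rank, rank, if_pos hv, if_pos hw]
    refine Finset.card_lt_card (Finset.ssubset_iff_of_subset ?_ |>.2 ⟨w, ?_, ?_⟩)
    · intro x
      simp only [Finset.mem_filter]
      exact fun h => ⟨h.1, h.2.trans hvw.le⟩
    · simp [hw]
    · simp [hvw]
  intro v hv w hw h
  rcases lt_trichotomy v w with h' | h' | h'
  · exact absurd h (key v hv w hw h').ne
  · exact h'
  · exact absurd h (key w hw v hv h').ne'

theorem rank_mem_cells (U : Finset V) : rank U ∈ cells U U.card := by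
  refine ⟨fun v => rank_ne_zero_iff.symm, rank_le_card U, fun j hj hjp => ?_⟩
  have himg : U.image (rank U) = Finset.Icc 1 U.card := by
    refine Finset.eq_of_subset_of_card_le (fun x hx => ?_) ?_
    · rw [Finset.mem_image] at hx
      obtain ⟨v, hv, rfl⟩ := hx
      exact Finset.mem_Icc.2 ⟨Nat.one_le_iff_ne_zero.2 (rank_ne_zero_iff.2 hv), rank_le_card U v⟩
    · rw [Finset.card_image_of_injOn (rank_injOn U)]
      simp
  have : j ∈ U.image (rank U) := by rw [himg]; exact Finset.mem_Icc.2 ⟨hj, hjp⟩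
  rw [Finset.mem_image] at this
  obtain ⟨v, _, hv⟩ := this
  exact ⟨v, hv⟩

/-- Because `u` is the maximum, `rank U` ends in the block `{u}`, and it is the only cell that
`dropLast` sends to `rank (U.erase u)`. So the coefficient detecting homology survives the
induction. -/
theorem dropLast_apply_rank_erase {U : Finset V} {p : ℕ} {u : V} (hu : u ∈ U)
    (hmax : ∀ v ∈ U, v ≤ u) (hp : U.card = p + 1) {z : (V → ℕ) →₀ K}
    (hz : z ∈ Finsupp.supported K K (cells U (p + 1))) :
    dropLast K u z (rank (U.erase u)) = z (rank U) := by
  classical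
  have hr := rank_of_forall_le hu hmax
  refine map_eq_of_supported (Finsupp.lapply (rank (U.erase u)) ∘ₗ dropLast K u)
    (Finsupp.lapply (rank U)) (fun f hf => ?_) hz
  simp only [LinearMap.comp_apply, Finsupp.lapply_apply]
  by_cases h : ∀ v, v ≠ u → f v < f u
  · have hfu := apply_eq_of_forall_lt hu hf h
    rw [dropLast_single_of_forall h, rank_erase hmax, Finsupp.single_apply, Finsupp.single_apply]
    congr 1
    refine propext ⟨fun h' => ?_, fun h' => by rw [h']⟩
    have := congrArg (fun f => Function.update f u (p + 1)) h'
    simp only [Function.update_idem] at this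
    rwa [← hfu, Function.update_eq_self, hfu, ← hp, ← hr, Function.update_eq_self] at this
  · rw [dropLast_single_of_not_forall h, Finsupp.single_apply, if_neg]
    · rfl
    · rintro rfl
      refine h fun v hv => ?_
      have h1 := rank_le_card U v
      rw [hr]
      refine lt_of_le_of_ne h1 fun h2 => hv ?_
      refine rank_injOn U (rank_ne_zero_iff.1 (by omega)) hu ?_
      rw [h2, hr]

/-- The complex of the cells with given support `U` is exact, but for the degree `#U` where the
coefficient at `rank U` detects the homology. -/
theorem cells_acyclic (U : Finset V) (p : ℕ) {z : (V → ℕ) →₀ K}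
    (hz : z ∈ Finsupp.supported K K (cells U p)) (hcyc : inner K V p z = 0)
    (htop : p = U.card → z (rank U) = 0) :
    ∃ y ∈ Finsupp.supported K K (cells U (p + 1)), inner K V (p + 1) y = z := by
  induction hn : U.card generalizing U p z with
  | zero =>
    rw [Finset.card_eq_zero] at hn
    subst hn
    refine ⟨0, Submodule.zero_mem _, ?_⟩
    rw [map_zero, eq_comm]
    ext f
    by_cases hf : f ∈ cells (∅ : Finset V) p
    · have hf0 : f = rank ∅ := by
        funext v
        have := hf.1 v
        simp only [Finset.notMem_empty, false_iff, not_not] at this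
        simp [this, rank]
      rcases p with _ | p
      · rw [hf0, htop rfl]
        rfl
      · obtain ⟨v, hv⟩ := hf.2.2 1 le_rfl (by omega)
        rw [hf0] at hv
        simp [rank] at hv
    · exact Finsupp.notMem_support_iff.1 fun h => hf (hz h)
  | succ n ih =>
    have hne : U.Nonempty := Finset.card_pos.1 (by omega)
    have hu := U.max'_mem hne
    have hmax : ∀ v ∈ U, v ≤ U.max' hne := fun v hv => U.le_max' v hv
    set u := U.max' hne
    have hcard : (U.erase u).card = n := by rw [Finset.card_erase_of_mem hu, hn]; rfl
    rcases p with _ | p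
    · refine ⟨0, Submodule.zero_mem _, ?_⟩
      rw [map_zero, eq_comm]
      ext f
      refine Finsupp.notMem_support_iff.1 fun h => ?_
      have := hz h
      have h1 := (this.1 u).1 hu
      have h2 := this.2.1 u
      omega
    obtain ⟨y, hy, hyz⟩ := ih (U.erase u) p (dropLast_mem_supported hu hz)
      (by rw [← dropLast_inner hu hz, hcyc, map_zero])
      (fun h => by rw [dropLast_apply_rank_erase hu hmax (by omega) hz, htop (by omega)]) hcard
    -- Lift the primitive `y` of `dropLast K u z` by appending `{u}` as a last block. Then `z -
    -- inner K V _ y'` is a cycle killed by `dropLast`, hence a boundary by `lowCells_acyclic`.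
    set y' := Finsupp.lmapDomain K K (fun f => Function.update f u (p + 1 + 1)) y
    have hy' : y' ∈ Finsupp.supported K K (cells U (p + 1 + 1)) := by
      refine map_mem_of_supported _ _ (fun f hf => ?_) hy
      rw [Finsupp.lmapDomain_apply, Finsupp.mapDomain_single]
      exact Finsupp.single_mem_supported K _ (update_last_mem_cells hu hf)
    have hdy : dropLast K u y' = y := by
      refine map_eq_of_supported (dropLast K u ∘ₗ Finsupp.lmapDomain K K
        (fun f => Function.update f u (p + 1 + 1))) LinearMap.id (fun f hf => ?_) hy
      rw [LinearMap.comp_apply, Finsupp.lmapDomain_apply, Finsupp.mapDomain_single,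
        dropLast_update_last hf, LinearMap.id_apply]
    obtain ⟨x, hx, hxz⟩ := lowCells_acyclic hu (p + 1 + 1)
      (mem_lowCells_of_dropLast_eq_zero hu (Submodule.sub_mem _ hz (inner_mem_supported hy'))
        (by rw [map_sub, dropLast_inner hu hy', hdy, hyz, sub_self]))
      (by rw [map_sub, hcyc, inner_inner, sub_zero])
    exact ⟨y' + x, Submodule.add_mem _ hy' hx, by rw [map_add, hxz]; abel⟩

end Rank

/-! ### The full boundary and the filtration by supports -/

section Boundary

variable {K : Type*} [Field K] {V : Type*}

/-- The effect on block indices of merging two cyclically adjacent blocks of `p + 2` blocks. -/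
def face (p i x : ℕ) : ℕ := if x ≤ i then (if x = p + 1 then 0 else x) else x - 1

/-- The boundary map of the cyclic complex, in terms of functions to `ℕ`. -/
noncomputable def bd (K : Type*) [Field K] (V : Type*) :
    ℕ → (((V → ℕ) →₀ K) →ₗ[K] ((V → ℕ) →₀ K))
  | 0 => 0
  | p + 1 => ∑ i ∈ Finset.range (p + 2), (-1 : K) ^ i • relabel K V (face p i)

theorem bd_succ_single (p : ℕ) (f : V → ℕ) (a : K) :
    bd K V (p + 1) (Finsupp.single f a) =
      ∑ i ∈ Finset.range (p + 2), (-1 : K) ^ i • Finsupp.single (face p i ∘ f) a := by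
  simp [bd, LinearMap.sum_apply]

theorem face_face {p i j x : ℕ} (hj : j ≤ i) (hi : i < p + 2) (hx : x ≤ p + 2) :
    face p i (face (p + 1) j x) = face p j (face (p + 1) (i + 1) x) := by
  simp only [face]
  split_ifs <;> omega

theorem bd_bd (p : ℕ) {z : (V → ℕ) →₀ K}
    (hz : z ∈ Finsupp.supported K K {f : V → ℕ | ∀ v, f v ≤ p + 1}) :
    bd K V p (bd K V (p + 1) z) = 0 := by
  rcases p with _ | p
  · simp [bd]
  refine map_eq_of_supported (bd K V (p + 1) ∘ₗ bd K V (p + 1 + 1)) 0 (fun f hf => ?_) hz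
  rw [LinearMap.comp_apply, bd_succ_single, map_sum]
  simp only [map_smul, bd_succ_single, LinearMap.zero_apply, Finset.smul_sum, smul_smul]
  rw [Finset.sum_comm]
  rw [← sum_alternating_faces_eq_zero (K := K) (p + 2)
    (fun i j => Finsupp.single (face p i ∘ face (p + 1) j ∘ f) (1 : K)) (fun i j hj hi => by
      congr 1
      funext v
      exact face_face hj hi (hf v))]
  refine Finset.sum_congr rfl fun i _ => Finset.sum_congr rfl fun j _ => ?_
  rw [← pow_add, add_comm]

theorem cells_unique {U U' : Finset V} {p p' : ℕ} {f : V → ℕ} (h : f ∈ cells U p)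
    (h' : f ∈ cells U' p') : U = U' := by
  ext v
  rw [h.1, h'.1]

theorem face_mem_cells [DecidableEq V] {U : Finset V} {p i : ℕ} {f : V → ℕ}
    (hf : f ∈ cells U (p + 1)) :
    face p i ∘ f ∈ cells (U.filter fun v => face p i (f v) ≠ 0) p := by
  obtain ⟨a, b, c⟩ := hf
  refine ⟨fun v => ?_, fun v => ?_, fun j hj hjp => ?_⟩
  · rw [Finset.mem_filter, a, Function.comp_apply, and_iff_right_iff_imp]
    intro h h'
    simp [face, h'] at h
  · have := b v
    simp only [Function.comp_apply, face]
    split_ifs <;> omega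
  · by_cases hji : j ≤ i
    · obtain ⟨v, hv⟩ := c j hj (by omega)
      exact ⟨v, by simp only [Function.comp_apply, hv, face]; split_ifs <;> omega⟩
    · obtain ⟨v, hv⟩ := c (j + 1) (by omega) (by omega)
      exact ⟨v, by simp only [Function.comp_apply, hv, face]; split_ifs <;> omega⟩

/-- Only the first and the last merge differ from the inner ones. They absorb a nonempty block into
block `0`, so the support shrinks strictly. -/
theorem bd_sub_inner_mem [DecidableEq V] {U : Finset V} {p : ℕ} {z : (V → ℕ) →₀ K}
    (hz : z ∈ Finsupp.supported K K (cells U (p + 1))) :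
    bd K V (p + 1) z - inner K V (p + 1) z ∈
      Finsupp.supported K K {f : V → ℕ | ∃ U' ⊂ U, f ∈ cells U' p} := by
  refine map_mem_of_supported (bd K V (p + 1) - inner K V (p + 1)) _ (fun f hf => ?_) hz
  rw [LinearMap.sub_apply, bd_succ_single, inner_single, Finset.sum_range_succ,
    Finset.range_eq_Ico, Finset.sum_eq_sum_Ico_succ_bot (by omega)]
  have hmid : ∑ i ∈ Finset.Ico (0 + 1) (p + 1), (-1 : K) ^ i •
      Finsupp.single (face p i ∘ f) (1 : K) =
      ∑ i ∈ Finset.Ico 1 (p + 1), (-1 : K) ^ i • Finsupp.single (collapse i ∘ f) (1 : K) := by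
    refine Finset.sum_congr rfl fun i hi => ?_
    rw [Finset.mem_Ico] at hi
    congr 2
    funext v
    have := hf.2.1 v
    simp only [Function.comp_apply, face, collapse]
    split_ifs <;> omega
  have hmem : ∀ i, (∃ v ∈ U, face p i (f v) = 0) → (-1 : K) ^ i •
      Finsupp.single (face p i ∘ f) (1 : K) ∈
        Finsupp.supported K K {f : V → ℕ | ∃ U' ⊂ U, f ∈ cells U' p} := by
    rintro i ⟨v, hv, hv0⟩
    refine Submodule.smul_mem _ _ (Finsupp.single_mem_supported K _
      ⟨_, Finset.filter_ssubset.2 ⟨v, hv, ?_⟩, face_mem_cells hf⟩)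
    simpa using hv0
  rw [hmid]
  convert Submodule.add_mem _ (hmem 0 ?_) (hmem (p + 1) ?_) using 1
  · abel
  · obtain ⟨v, hv⟩ := hf.2.2 1 le_rfl (by omega)
    exact ⟨v, (hf.1 v).2 (by omega), by simp [hv, face]⟩
  · obtain ⟨v, hv⟩ := hf.2.2 (p + 1) (by omega) le_rfl
    exact ⟨v, (hf.1 v).2 (by omega), by simp [hv, face]⟩

open Classical in
/-- The projection to the span of the cells with support `U`. -/
noncomputable def cellProj (K : Type*) [Field K] (U : Finset V) (p : ℕ) :
    ((V → ℕ) →₀ K) →ₗ[K] ((V → ℕ) →₀ K) :=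
  Finsupp.linearCombination K fun f => if f ∈ cells U p then Finsupp.single f 1 else 0

theorem cellProj_single_of_mem {U : Finset V} {p : ℕ} {f : V → ℕ} (h : f ∈ cells U p) :
    cellProj K U p (Finsupp.single f 1) = Finsupp.single f 1 := by
  rw [cellProj, Finsupp.linearCombination_single, one_smul, if_pos h]

theorem cellProj_single_of_notMem {U : Finset V} {p : ℕ} {f : V → ℕ} (h : f ∉ cells U p) :
    cellProj K U p (Finsupp.single f 1) = 0 := by
  rw [cellProj, Finsupp.linearCombination_single, one_smul, if_neg h]

theorem cellProj_eq_self {U : Finset V} {p : ℕ} {z : (V → ℕ) →₀ K}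
    (hz : z ∈ Finsupp.supported K K (cells U p)) : cellProj K U p z = z :=
  map_eq_of_supported _ LinearMap.id (fun _ hf => cellProj_single_of_mem hf) hz

theorem cellProj_eq_zero {U : Finset V} {p : ℕ} {s : Set (V → ℕ)} (hs : ∀ f ∈ s, f ∉ cells U p)
    {z : (V → ℕ) →₀ K} (hz : z ∈ Finsupp.supported K K s) : cellProj K U p z = 0 :=
  map_eq_of_supported _ 0 (fun f hf => cellProj_single_of_notMem (hs f hf)) hz

theorem cellProj_mem_supported (U : Finset V) (p : ℕ) (z : (V → ℕ) →₀ K) :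
    cellProj K U p z ∈ Finsupp.supported K K (cells U p) := by
  have : z ∈ Finsupp.supported K K (Set.univ : Set (V → ℕ)) := by simp
  refine map_mem_of_supported _ _ (fun f _ => ?_) this
  by_cases h : f ∈ cells U p
  · rw [cellProj_single_of_mem h]
    exact Finsupp.single_mem_supported K _ h
  · rw [cellProj_single_of_notMem h]
    exact Submodule.zero_mem _

/-- The cells whose supports lie in the family `𝒦`. -/
def cellsOver (𝒦 : Finset (Finset V)) (p : ℕ) : Set (V → ℕ) := {f | ∃ U ∈ 𝒦, f ∈ cells U p}

theorem cellsOver_subset_le (𝒦 : Finset (Finset V)) (p : ℕ) :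
    cellsOver 𝒦 p ⊆ {f : V → ℕ | ∀ v, f v ≤ p} := by
  rintro f ⟨U, _, hf⟩
  exact hf.2.1

/-- Supports only shrink under `bd`, so a maximal `U` receives nothing from other supports.
Projecting to it is a chain map to the inner complex. -/
theorem inner_cellProj [DecidableEq V] {𝒦 : Finset (Finset V)} {U : Finset V}
    (hmax : ∀ U' ∈ 𝒦, U ⊆ U' → U' = U) {p : ℕ} {z : (V → ℕ) →₀ K}
    (hz : z ∈ Finsupp.supported K K (cellsOver 𝒦 (p + 1))) :
    inner K V (p + 1) (cellProj K U (p + 1) z) = cellProj K U p (bd K V (p + 1) z) := by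
  refine map_eq_of_supported (inner K V (p + 1) ∘ₗ cellProj K U (p + 1))
    (cellProj K U p ∘ₗ bd K V (p + 1)) (fun f hf => ?_) hz
  obtain ⟨U', hU', hf⟩ := hf
  simp only [LinearMap.comp_apply]
  by_cases h : U' = U
  · subst h
    have h1 := Finsupp.single_mem_supported K (1 : K) hf
    rw [cellProj_single_of_mem hf, ← cellProj_eq_self (inner_mem_supported h1), eq_comm,
      ← sub_eq_zero, ← map_sub]
    refine cellProj_eq_zero (fun f' hf' h' => ?_) (bd_sub_inner_mem h1)
    obtain ⟨U'', hU'', h''⟩ := hf'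
    exact hU''.ne (cells_unique h'' h')
  · rw [cellProj_single_of_notMem fun h' => h (cells_unique hf h'), map_zero, bd_succ_single,
      map_sum, eq_comm]
    refine Finset.sum_eq_zero fun i _ => ?_
    rw [map_smul, cellProj_single_of_notMem, smul_zero]
    intro h'
    have := cells_unique (face_mem_cells hf) h'
    exact h (hmax U' hU' (this ▸ Finset.filter_subset _ _))

end Boundary

/-! ### Cocycles that detect the homology -/

section Cocycle

variable {K : Type*} [Field K] {V : Type*} [LinearOrder V]

open Classical in
/-- The cocycle dual to the torus class of `U`. -/
noncomputable def cocycle (K : Type*) [Field K] (U : Finset V) : ((V → ℕ) →₀ K) →ₗ[K] K :=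
  Finsupp.linearCombination K fun f => if ∀ v ∈ U, f v = rank U v then 1 else 0

open Classical in
theorem cocycle_single (U : Finset V) (f : V → ℕ) :
    cocycle K U (Finsupp.single f 1) = if ∀ v ∈ U, f v = rank U v then 1 else 0 := by
  rw [cocycle, Finsupp.linearCombination_single, one_smul]

theorem face_eq_iff {p i x r : ℕ} (hi : i ≤ p + 1) (hr : 1 ≤ r) (hrp : r ≤ p) :
    face p i x = r ↔ (r < i → x = r) ∧ (r = i → x = r ∨ x = r + 1) ∧ (i < r → x = r + 1) := by
  simp only [face]
  split_ifs <;> omega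

/-- A face of `f` restricts to `rank U` on `U` only if `f` enumerates `U` increasingly with one
value among `1, …, p + 1` skipped. Such an `f` contributes through two adjacent faces with opposite
signs, so the alternating sum telescopes. -/
theorem cocycle_bd {U : Finset V} {p : ℕ} (hU : U.card = p) {z : (V → ℕ) →₀ K}
    (hz : z ∈ Finsupp.supported K K {f : V → ℕ | ∀ v, f v ≤ p + 1}) :
    cocycle K U (bd K V (p + 1) z) = 0 := by
  classical
  refine map_eq_of_supported (cocycle K U ∘ₗ bd K V (p + 1)) 0 (fun f hf => ?_) hz
  rw [LinearMap.comp_apply, bd_succ_single, map_sum, LinearMap.zero_apply]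
  simp only [map_smul, cocycle_single, Function.comp_apply, smul_eq_mul]
  have hrank : ∀ v ∈ U, 1 ≤ rank U v ∧ rank U v ≤ p := fun v hv =>
    ⟨Nat.one_le_iff_ne_zero.2 (rank_ne_zero_iff.2 hv), hU ▸ rank_le_card U v⟩
  -- `Q t` says that the skipped value is `t + 1`. Face `i` contributes when `Q (i - 1)` or `Q i`
  -- holds, except that the first and the last face see only `Q 0` and `Q p`.
  set Q : ℕ → Prop := fun t => ∀ v ∈ U, (rank U v ≤ t → f v = rank U v) ∧
    (t < rank U v → f v = rank U v + 1) with hQ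
  have hP : ∀ i ≤ p + 1, (∀ v ∈ U, face p i (f v) = rank U v) ↔ ∀ v ∈ U,
      (rank U v < i → f v = rank U v) ∧ (rank U v = i → f v = rank U v ∨ f v = rank U v + 1) ∧
        (i < rank U v → f v = rank U v + 1) := fun i hi =>
    forall₂_congr fun v hv => face_eq_iff hi (hrank v hv).1 (hrank v hv).2
  have h0 : (∀ v ∈ U, face p 0 (f v) = rank U v) ↔ Q 0 := by
    rw [hP 0 (by omega)]
    refine forall₂_congr fun v hv => ?_
    have := hrank v hv
    omega
  have hlast : (∀ v ∈ U, face p (p + 1) (f v) = rank U v) ↔ Q p := by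
    rw [hP (p + 1) le_rfl]
    refine forall₂_congr fun v hv => ?_
    have := hrank v hv
    omega
  have hmid : ∀ i ∈ Finset.range p,
      (-1 : K) ^ (i + 1) * (if ∀ v ∈ U, face p (i + 1) (f v) = rank U v then 1 else 0) =
        (-1) ^ (i + 1) * (if Q (i + 1) then 1 else 0) - (-1) ^ i * (if Q i then 1 else 0) := by
    intro i hi
    rw [Finset.mem_range] at hi
    obtain ⟨w, hw⟩ := (rank_mem_cells U).2.2 (i + 1) (by omega) (by omega)
    have hwU : w ∈ U := rank_ne_zero_iff.1 (by omega)
    have hiff : (∀ v ∈ U, face p (i + 1) (f v) = rank U v) ↔ Q (i + 1) ∨ Q i := by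
      rw [hP (i + 1) (by omega)]
      constructor
      · intro h
        rcases (h w hwU).2.1 hw with h1 | h1
        · left
          intro v hv
          obtain ⟨a, b, c⟩ := h v hv
          refine ⟨fun hle => ?_, c⟩
          rcases hle.lt_or_eq with h2 | h2
          · exact a h2
          · rw [rank_injOn U hv hwU (h2.trans hw.symm)]; exact h1
        · right
          intro v hv
          obtain ⟨a, b, c⟩ := h v hv
          refine ⟨fun hle => a (by omega), fun hlt => ?_⟩
          rcases (Nat.succ_le_of_lt hlt).lt_or_eq with h2 | h2
          · exact c h2
          · rw [rank_injOn U hv hwU (h2.symm.trans hw.symm)]; exact h1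
      · rintro (h | h) v hv
        · have := h v hv
          omega
        · have := h v hv
          omega
    have hnot : ¬ (Q (i + 1) ∧ Q i) := by
      rintro ⟨h1, h2⟩
      have h3 := (h1 w hwU).1 (by omega)
      have h4 := (h2 w hwU).2 (by omega)
      omega
    simp only [hiff]
    by_cases h1 : Q (i + 1) <;> by_cases h2 : Q i
    · exact absurd ⟨h1, h2⟩ hnot
    all_goals simp [h1, h2, pow_succ]
  rw [Finset.sum_range_succ, Finset.sum_range_succ', Finset.sum_congr rfl hmid,
    Finset.sum_range_sub (fun i => (-1 : K) ^ i * (if Q i then 1 else 0))]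
  simp only [h0, hlast, pow_succ]
  ring

/-- A cell agreeing with `rank U` on `U` has support containing `U`. Maximality forces equality, and
the cell is then `rank U` itself. -/
theorem cocycle_eq_cellProj_apply {𝒦 : Finset (Finset V)} {U : Finset V}
    (hmax : ∀ U' ∈ 𝒦, U ⊆ U' → U' = U) {p : ℕ} {z : (V → ℕ) →₀ K}
    (hz : z ∈ Finsupp.supported K K (cellsOver 𝒦 p)) :
    cocycle K U z = cellProj K U p z (rank U) := by
  classical
  refine map_eq_of_supported (cocycle K U) (Finsupp.lapply (rank U) ∘ₗ cellProj K U p)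
    (fun f hf => ?_) hz
  obtain ⟨U', hU', hf⟩ := hf
  rw [cocycle_single, LinearMap.comp_apply, Finsupp.lapply_apply]
  by_cases h : U' = U
  · subst h
    rw [cellProj_single_of_mem hf, Finsupp.single_apply]
    congr 1
    refine propext ⟨fun h => funext fun v => ?_, fun h v _ => by rw [h]⟩
    by_cases hv : v ∈ U'
    · exact h v hv
    · rw [not_not.1 (mt (hf.1 v).2 hv), rank, if_neg hv]
  · rw [cellProj_single_of_notMem fun h' => h (cells_unique hf h'), if_neg]
    · rfl
    · intro h'
      refine h (hmax U' hU' fun v hv => ?_)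
      rw [hf.1, h' v hv]
      exact rank_ne_zero_iff.2 hv

/-- A cycle on which all the cocycles vanish is a boundary. -/
theorem exists_bd_eq_of_cocycle_eq_zero (𝒦 : Finset (Finset V))
    (hlow : ∀ U ∈ 𝒦, ∀ U' ⊆ U, U' ∈ 𝒦) {p : ℕ} {z : (V → ℕ) →₀ K}
    (hz : z ∈ Finsupp.supported K K (cellsOver 𝒦 p)) (hcyc : bd K V p z = 0)
    (hco : ∀ U ∈ 𝒦, U.card = p → cocycle K U z = 0) :
    ∃ y ∈ Finsupp.supported K K (cellsOver 𝒦 (p + 1)), bd K V (p + 1) y = z := by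
  induction hn : 𝒦.card generalizing 𝒦 z with
  | zero =>
    rw [Finset.card_eq_zero] at hn
    have : cellsOver 𝒦 p = ∅ := by ext; simp [cellsOver, hn]
    rw [this, Finsupp.supported_empty, Submodule.mem_bot] at hz
    exact ⟨0, Submodule.zero_mem _, by simp [hz]⟩
  | succ n ih =>
    obtain ⟨U, hUmax⟩ := 𝒦.exists_maximal (Finset.card_pos.1 (by omega))
    have hU : U ∈ 𝒦 := hUmax.1
    have hmax : ∀ U' ∈ 𝒦, U ⊆ U' → U' = U := fun U' hU' h => (hUmax.2 hU' h).antisymm h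
    -- The part of `z` over the maximal set `U` is an inner boundary. Subtracting the full boundary
    -- of its primitive leaves a cycle over the smaller, still downward closed family `𝒦.erase U`.
    obtain ⟨y, hy, hyz⟩ := cells_acyclic U p (cellProj_mem_supported U p z)
      (by
        rcases p with _ | p
        · simp [inner]
        · rw [inner_cellProj hmax hz, hcyc, map_zero])
      (fun h => by rw [← cocycle_eq_cellProj_apply hmax hz, hco U hU h.symm])
    have hyK : y ∈ Finsupp.supported K K (cellsOver 𝒦 (p + 1)) :=
      Finsupp.supported_mono (t := cellsOver 𝒦 (p + 1)) (fun f hf => ⟨U, hU, hf⟩) hy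
    have hyle := Finsupp.supported_mono (R := K) (M := K) (cellsOver_subset_le 𝒦 (p + 1)) hyK
    have hlow' : ∀ U' ∈ 𝒦.erase U, ∀ U'' ⊆ U', U'' ∈ 𝒦.erase U := by
      intro U' hU' U'' h
      rw [Finset.mem_erase] at hU' ⊢
      exact ⟨by rintro rfl; exact hU'.1 (hmax U' hU'.2 h), hlow U' hU'.2 U'' h⟩
    have hrest : z - cellProj K U p z ∈ Finsupp.supported K K (cellsOver (𝒦.erase U) p) := by
      refine map_mem_of_supported (LinearMap.id - cellProj K U p) _ (fun f hf => ?_) hz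
      obtain ⟨U', hU', hf⟩ := hf
      rw [LinearMap.sub_apply, LinearMap.id_apply]
      by_cases h : U' = U
      · subst h
        rw [cellProj_single_of_mem hf, sub_self]
        exact Submodule.zero_mem _
      · rw [cellProj_single_of_notMem fun h' => h (cells_unique hf h'), sub_zero]
        exact Finsupp.single_mem_supported K _ ⟨U', Finset.mem_erase.2 ⟨h, hU'⟩, hf⟩
    have hlower : bd K V (p + 1) y - inner K V (p + 1) y ∈
        Finsupp.supported K K (cellsOver (𝒦.erase U) p) := by
      refine Finsupp.supported_mono ?_ (bd_sub_inner_mem hy)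
      rintro f ⟨U', hU', hf⟩
      exact ⟨U', Finset.mem_erase.2 ⟨hU'.ne, hlow U hU U' hU'.subset⟩, hf⟩
    obtain ⟨x, hx, hxz⟩ := ih (𝒦.erase U) hlow' (z := z - bd K V (p + 1) y)
      (by
        convert Submodule.sub_mem _ hrest hlower using 1
        rw [hyz]
        abel)
      (by rw [map_sub, hcyc, bd_bd p hyle, sub_zero])
      (fun U' hU' hc => by
        rw [map_sub, hco U' (Finset.mem_of_mem_erase hU') hc, cocycle_bd hc hyle, sub_zero])
      (by rw [Finset.card_erase_of_mem hU, hn]; rfl)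
    refine ⟨y + x, Submodule.add_mem _ hyK (Finsupp.supported_mono ?_ hx), ?_⟩
    · rintro f ⟨U', hU', hf⟩
      exact ⟨U', Finset.mem_of_mem_erase hU', hf⟩
    · rw [map_add, hxz]
      abel

end Cocycle

/-! ### Fundamental cycles of the coordinate tori -/

section TorusClass

variable {K : Type*} [Field K] {V : Type*} [LinearOrder V]

/-- The permutation `σ` of `{1, …, p}`, extended by zero. -/
def permExt {p : ℕ} (σ : Equiv.Perm (Fin p)) (x : ℕ) : ℕ :=
  if h : 0 < x ∧ x ≤ p then σ ⟨x - 1, by omega⟩ + 1 else 0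

/-- The alternating sum over all orderings of `U`. -/
noncomputable def torusClass (K : Type*) [Field K] (U : Finset V) (p : ℕ) : (V → ℕ) →₀ K :=
  ∑ σ : Equiv.Perm (Fin p), ((Equiv.Perm.sign σ : ℤ) : K) •
    Finsupp.single (permExt σ ∘ rank U) 1

theorem permExt_ne_zero_iff {p : ℕ} (σ : Equiv.Perm (Fin p)) {x : ℕ} (hx : x ≤ p) :
    permExt σ x ≠ 0 ↔ x ≠ 0 := by
  unfold permExt
  split_ifs <;> omega

theorem permExt_le {p : ℕ} (σ : Equiv.Perm (Fin p)) (x : ℕ) : permExt σ x ≤ p := by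
  unfold permExt
  split_ifs
  · exact (σ _).isLt
  · omega

theorem permExt_comp_rank_mem_cells {U : Finset V} {p : ℕ} (hU : U.card = p)
    (σ : Equiv.Perm (Fin p)) : permExt σ ∘ rank U ∈ cells U p := by
  refine ⟨fun v => ?_, fun v => permExt_le σ _, fun j hj hjp => ?_⟩
  · rw [Function.comp_apply, permExt_ne_zero_iff σ (hU ▸ rank_le_card U v), rank_ne_zero_iff]
  · set x := σ.symm ⟨j - 1, by omega⟩ with hx
    obtain ⟨v, hv⟩ := (rank_mem_cells U).2.2 (x + 1) (by omega) (by omega)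
    refine ⟨v, ?_⟩
    rw [Function.comp_apply, hv, permExt, dif_pos (by omega)]
    have : (⟨(x : ℕ) + 1 - 1, by omega⟩ : Fin p) = x := Fin.ext (by simp)
    rw [this, hx, Equiv.apply_symm_apply]
    simp only
    omega

theorem torusClass_mem_supported {U : Finset V} {p : ℕ} (hU : U.card = p) :
    torusClass K U p ∈ Finsupp.supported K K (cells U p) :=
  Submodule.sum_mem _ fun σ _ => Submodule.smul_mem _ _
    (Finsupp.single_mem_supported K _ (permExt_comp_rank_mem_cells hU σ))

theorem face_permExt_swap {q : ℕ} (σ : Equiv.Perm (Fin (q + 1))) (i x : ℕ) (hi : 1 ≤ i)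
    (hiq : i < q + 1) :
    face q i (permExt (Equiv.swap ⟨i - 1, by omega⟩ ⟨i, hiq⟩ * σ) x) = face q i (permExt σ x) := by
  unfold permExt
  split_ifs with h
  · rw [Equiv.Perm.mul_apply]
    generalize σ _ = a
    rw [Equiv.swap_apply_def]
    have ha := a.isLt
    split_ifs with h1 h2
    · subst h1
      simp only [face]
      split_ifs <;> omega
    · subst h2
      simp only [face]
      split_ifs <;> omega
    · rfl
  · rfl

theorem face_permExt_rotate {q : ℕ} (σ : Equiv.Perm (Fin (q + 1))) (x : ℕ) :
    face q (q + 1) (permExt σ x) = face q 0 (permExt (finRotate (q + 1) * σ) x) := by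
  unfold permExt
  split_ifs with h
  · rw [Equiv.Perm.mul_apply]
    generalize σ _ = a
    rw [coe_finRotate]
    have ha := a.isLt
    simp only [face, Fin.ext_iff, Fin.val_last]
    split_ifs <;> omega
  · simp [face]

/-- Merging blocks `i` and `i + 1` is insensitive to swapping them, so antisymmetry kills the middle
faces. Merging the last block into block `0` agrees with merging the first one after a cyclic
rotation, whose sign makes the two outer faces cancel. -/
theorem bd_torusClass [CharZero K] (U : Finset V) (p : ℕ) : bd K V p (torusClass K U p) = 0 := by
  rcases p with _ | q
  · rfl
  set T : ℕ → ((V → ℕ) →₀ K) := fun i => ∑ σ : Equiv.Perm (Fin (q + 1)),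
    ((Equiv.Perm.sign σ : ℤ) : K) • Finsupp.single (face q i ∘ permExt σ ∘ rank U) 1 with hT
  have hsum : bd K V (q + 1) (torusClass K U (q + 1)) =
      ∑ i ∈ Finset.range (q + 2), (-1 : K) ^ i • T i := by
    simp only [torusClass, map_sum, map_smul, bd_succ_single, hT, Finset.smul_sum]
    rw [Finset.sum_comm]
    exact Finset.sum_congr rfl fun i _ => Finset.sum_congr rfl fun σ _ => smul_comm _ _ _
  have hmid : ∀ i ∈ Finset.Ico (0 + 1) (q + 1), (-1 : K) ^ i • T i = 0 := by
    intro i hi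
    rw [Finset.mem_Ico] at hi
    set τ : Equiv.Perm (Fin (q + 1)) := Equiv.swap ⟨i - 1, by omega⟩ ⟨i, hi.2⟩ with hτ
    have hneg : T i = -T i := by
      conv_lhs => rw [hT]
      simp only
      rw [← Equiv.sum_comp (Equiv.mulLeft τ), hT, ← Finset.sum_neg_distrib]
      refine Finset.sum_congr rfl fun σ _ => ?_
      rw [Equiv.coe_mulLeft, Equiv.Perm.sign_mul, Equiv.Perm.sign_swap (by
        rw [ne_eq, Fin.mk.injEq]; omega), ← neg_smul]
      congr 2
      · simp
      · funext v
        exact face_permExt_swap σ i _ (by omega) hi.2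
    -- Passing from `T i = -T i` to `T i = 0` divides by two, which the characteristic permits.
    rw [self_eq_neg.1 hneg, smul_zero]
  have hlast : T (q + 1) = (-1 : K) ^ q • T 0 := by
    conv_rhs => rw [hT]
    simp only
    rw [← Equiv.sum_comp (Equiv.mulLeft (finRotate (q + 1))), hT, Finset.smul_sum]
    refine Finset.sum_congr rfl fun σ _ => ?_
    rw [Equiv.coe_mulLeft, Equiv.Perm.sign_mul, sign_finRotate, smul_smul]
    congr 2
    · push_cast
      rw [← mul_assoc, ← mul_pow]
      simp
    · funext v
      exact face_permExt_rotate σ _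
  rw [hsum, Finset.sum_range_succ, Finset.range_eq_Ico,
    Finset.sum_eq_sum_Ico_succ_bot (by omega), Finset.sum_eq_zero hmid, hlast, smul_smul, add_zero,
    ← add_smul]
  convert zero_smul K _
  rw [pow_succ, mul_right_comm, ← mul_pow]
  simp

theorem cocycle_torusClass_self {U : Finset V} {p : ℕ} (hU : U.card = p) :
    cocycle K U (torusClass K U p) = 1 := by
  classical
  simp only [torusClass, map_sum, map_smul, cocycle_single, Function.comp_apply]
  rw [Finset.sum_eq_single 1]
  · rw [if_pos]
    · simp
    · intro v hv
      have h1 := rank_le_card U v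
      have h2 := rank_ne_zero_iff.2 hv
      rw [permExt, dif_pos (by omega)]
      simp only [Equiv.Perm.coe_one, id_eq]
      omega
  · intro σ _ hσ
    rw [if_neg, smul_zero]
    refine fun h => hσ (Equiv.ext fun x => Fin.ext ?_)
    obtain ⟨v, hv⟩ := (rank_mem_cells U).2.2 (x + 1) (by omega) (by omega)
    have := h v (rank_ne_zero_iff.1 (by omega))
    rw [hv, permExt, dif_pos (by omega)] at this
    simpa using this
  · simp

/-- All cells of the torus class have support `U`. Agreement with `rank U'` on `U'` would put `U'`
inside `U`, and equal cardinalities would force `U' = U`. -/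
theorem cocycle_torusClass_of_ne {U U' : Finset V} {p : ℕ} (hU : U.card = p) (hU' : U'.card = p)
    (h : U' ≠ U) : cocycle K U' (torusClass K U p) = 0 := by
  classical
  simp only [torusClass, map_sum, map_smul, cocycle_single, Function.comp_apply]
  refine Finset.sum_eq_zero fun σ _ => ?_
  rw [if_neg, smul_zero]
  refine fun h' => h (Finset.eq_of_subset_of_card_le (fun v hv => ?_) (by omega))
  rw [← rank_ne_zero_iff, ← permExt_ne_zero_iff σ (hU ▸ rank_le_card U v), h' v hv]
  exact rank_ne_zero_iff.2 hv

end TorusClass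

theorem finrank_subquotient_of_surjective {K M N : Type*} [Field K] [AddCommGroup M] [Module K M]
    [AddCommGroup N] [Module K N] {Z B : Submodule K M} (Φ : Z →ₗ[K] N)
    (hker : LinearMap.ker Φ = B.submoduleOf Z) (hsurj : Function.Surjective Φ) :
    Module.finrank K (Subquotient Z B) = Module.finrank K N := by
  unfold Subquotient
  rw [← hker]
  exact (Φ.quotKerEquivOfSurjective hsurj).finrank_eq

/-! ### Homology when every hyperedge contains the distinguished vertex -/

section FaceHomology

variable {K : Type*} [Field K] {V : Type*} {H : Hypergraph V} {v₀ : V}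

/-- A face as a function to `ℕ`. -/
def faceVal {p : ℕ} (f : Face H v₀ p) (v : V) : ℕ := f.1 v

theorem faceVal_injective {p : ℕ} :
    Function.Injective (faceVal : Face H v₀ p → V → ℕ) := fun _ _ h =>
  Subtype.ext (funext fun v => Fin.ext (congrFun h v))

theorem faceVal_mergeFace {p : ℕ} (i : Fin (p + 2)) (f : Face H v₀ (p + 1)) :
    faceVal (mergeFace i f) = face p i ∘ faceVal f := by
  funext v
  exact merge_val i (f.1 v)

/-- The embedding of the chain spaces in the span of all functions to `ℕ`. -/
noncomputable def chainVal (K : Type*) [Field K] (H : Hypergraph V) (v₀ : V) (p : ℕ) :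
    Chain K H v₀ p →ₗ[K] ((V → ℕ) →₀ K) :=
  Finsupp.lmapDomain K K faceVal

theorem chainVal_injective (p : ℕ) : Function.Injective (chainVal K H v₀ p) :=
  Finsupp.mapDomain_injective faceVal_injective

theorem bd_chainVal (p : ℕ) (z : Chain K H v₀ (p + 1)) :
    bd K V (p + 1) (chainVal K H v₀ (p + 1) z) = chainVal K H v₀ p (boundary K H v₀ p z) := by
  refine LinearMap.congr_fun (f := bd K V (p + 1) ∘ₗ chainVal K H v₀ (p + 1))
    (g := chainVal K H v₀ p ∘ₗ boundary K H v₀ p) (Finsupp.lhom_ext fun f a => ?_) z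
  simp only [LinearMap.comp_apply, boundary_single, map_sum, chainVal, Finsupp.lmapDomain_apply,
    Finsupp.mapDomain_single, bd_succ_single, faceVal_mergeFace]
  rw [Finset.sum_range]
  simp

theorem mem_cycles_iff (p : ℕ) (z : Chain K H v₀ p) :
    z ∈ cycles K H v₀ p ↔ bd K V p (chainVal K H v₀ p z) = 0 := by
  rcases p with _ | p
  · simp [cycles, bd]
  · rw [cycles, LinearMap.mem_ker, bd_chainVal, map_eq_zero_iff _ (chainVal_injective p)]

variable [Fintype V]

open Classical in
/-- The sets of vertices that are disjoint from some hyperedge. -/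
noncomputable def avoidingSets (H : Hypergraph V) : Finset (Finset V) :=
  {U : Finset V | ∃ e ∈ H.edgeSet, ∀ v ∈ e, v ∉ U}

theorem mem_avoidingSets {U : Finset V} :
    U ∈ avoidingSets H ↔ ∃ e ∈ H.edgeSet, ∀ v ∈ e, v ∉ U := by
  simp [avoidingSets]

theorem avoidingSets_lower (U : Finset V) (hU : U ∈ avoidingSets H) (U' : Finset V)
    (h : U' ⊆ U) : U' ∈ avoidingSets H := by
  rw [mem_avoidingSets] at hU ⊢
  obtain ⟨e, he, hv⟩ := hU
  exact ⟨e, he, fun v hve hvU => hv v hve (h hvU)⟩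

/-- A block containing a hyperedge contains `v₀`, hence is block `0`. The hyperedge condition
therefore depends only on the support. -/
theorem range_faceVal (hv : ∀ e ∈ H.edgeSet, v₀ ∈ e) (p : ℕ) :
    Set.range (faceVal : Face H v₀ p → V → ℕ) = cellsOver (avoidingSets H) p := by
  classical
  ext f
  constructor
  · rintro ⟨f, rfl⟩
    obtain ⟨f, hsurj, h0, e, he, i, hi⟩ := f
    refine ⟨Finset.univ.filter fun v => f v ≠ 0, ?_, fun v => ?_, fun v => ?_, fun j _ hj => ?_⟩
    · rw [mem_avoidingSets]
      refine ⟨e, he, fun v hve => ?_⟩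
      have : f v = 0 := (hi v hve).trans ((hi v₀ (hv e he)).symm.trans h0)
      rw [Finset.mem_filter]
      rintro ⟨-, h⟩
      exact h this
    · rw [Finset.mem_filter, and_iff_right (Finset.mem_univ v)]
      exact not_congr Fin.ext_iff
    · exact Nat.lt_succ_iff.1 (f v).isLt
    · obtain ⟨v, hv⟩ := hsurj ⟨j, by omega⟩
      exact ⟨v, by simp [faceVal, hv]⟩
  · rintro ⟨U, hU, h1, h2, h3⟩
    rw [mem_avoidingSets] at hU
    obtain ⟨e, he, hU⟩ := hU
    have hzero : ∀ v ∈ e, f v = 0 := fun v hve => not_not.1 (mt (h1 v).2 (hU v hve))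
    have h0 := hzero v₀ (hv e he)
    refine ⟨⟨fun v => ⟨f v, Nat.lt_succ_iff.2 (h2 v)⟩, fun j => ?_, Fin.ext h0, e, he, 0,
      fun v hve => Fin.ext (hzero v hve)⟩, rfl⟩
    rcases Nat.eq_zero_or_pos j with hj | hj
    · exact ⟨v₀, Fin.ext (h0.trans hj.symm)⟩
    · obtain ⟨v, hv⟩ := h3 j hj (Nat.lt_succ_iff.1 j.isLt)
      exact ⟨v, Fin.ext hv⟩

theorem range_chainVal (hv : ∀ e ∈ H.edgeSet, v₀ ∈ e) (p : ℕ) :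
    LinearMap.range (chainVal K H v₀ p) =
      Finsupp.supported K K (cellsOver (avoidingSets H) p) := by
  rw [← range_faceVal hv, ← Set.image_univ, ← Finsupp.lmapDomain_supported,
    Finsupp.supported_univ, Submodule.map_top]
  rfl

/-- If all the hyperedges contain the distinguished vertex, then the torus classes of the sets
that avoid some hyperedge form a basis of the homology. -/
theorem finrank_homology_of_mem_edges [CharZero K] (hv : ∀ e ∈ H.edgeSet, v₀ ∈ e) (p : ℕ) :
    Module.finrank K (Subquotient (cycles K H v₀ p) (LinearMap.range (boundary K H v₀ p))) =
      ((avoidingSets H).filter fun U => U.card = p).card := by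
  classical
  -- Any linear order on the vertices serves: it only fixes the reference ordering `rank U`.
  let _ : LinearOrder V := LinearOrder.lift' _ (Fintype.equivFin V).injective
  set I := (avoidingSets H).filter fun U => U.card = p with hI
  let Φ : cycles K H v₀ p →ₗ[K] (I → K) :=
    LinearMap.pi fun U => cocycle K U.1 ∘ₗ chainVal K H v₀ p ∘ₗ (cycles K H v₀ p).subtype
  have hmem : ∀ q (z : Chain K H v₀ q), chainVal K H v₀ q z ∈
      Finsupp.supported K K (cellsOver (avoidingSets H) q) := fun q z => by
    rw [← range_chainVal hv]
    exact ⟨z, rfl⟩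
  have hker : LinearMap.ker Φ =
      (LinearMap.range (boundary K H v₀ p)).submoduleOf (cycles K H v₀ p) := by
    ext ⟨z, hz⟩
    rw [LinearMap.mem_ker, Submodule.submoduleOf, Submodule.mem_comap, LinearMap.mem_range,
      funext_iff]
    constructor
    · intro h
      obtain ⟨y, hy, hyz⟩ := exists_bd_eq_of_cocycle_eq_zero (avoidingSets H) avoidingSets_lower
        (hmem p z) ((mem_cycles_iff p z).1 hz)
        (fun U hU hc => h ⟨U, Finset.mem_filter.2 ⟨hU, hc⟩⟩)
      rw [← range_chainVal hv] at hy
      obtain ⟨x, rfl⟩ := hy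
      exact ⟨x, chainVal_injective p (by rw [← bd_chainVal, hyz]; rfl)⟩
    · rintro ⟨x, hx⟩ U
      change cocycle K U.1 (chainVal K H v₀ p z) = 0
      have hx' : boundary K H v₀ p x = z := hx
      rw [← hx', ← bd_chainVal, cocycle_bd (Finset.mem_filter.1 U.2).2]
      exact Finsupp.supported_mono (cellsOver_subset_le _ _) (hmem (p + 1) x)
  have hsurj : LinearMap.range Φ = ⊤ := by
    rw [eq_top_iff, ← (Pi.basisFun K I).span_eq, Submodule.span_le]
    rintro _ ⟨U, rfl⟩
    obtain ⟨hU, hc⟩ := Finset.mem_filter.1 U.2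
    have hcell := torusClass_mem_supported (K := K) hc
    have h1 : torusClass K U.1 p ∈ LinearMap.range (chainVal K H v₀ p) := by
      rw [range_chainVal hv]
      exact Finsupp.supported_mono (t := cellsOver (avoidingSets H) p) (fun f hf => ⟨U.1, hU, hf⟩) hcell
    obtain ⟨x, hx⟩ := h1
    refine ⟨⟨x, (mem_cycles_iff p x).2 (by rw [hx, bd_torusClass])⟩, funext fun U' => ?_⟩
    change cocycle K U'.1 (chainVal K H v₀ p x) = _
    rw [hx, Pi.basisFun_apply, Pi.single_apply]
    split_ifs with h
    · rw [h, cocycle_torusClass_self hc]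
    · exact cocycle_torusClass_of_ne hc (Finset.mem_filter.1 U'.2).2 fun h' => h (Subtype.ext h')
  rw [finrank_subquotient_of_surjective Φ hker (LinearMap.range_eq_top.1 hsurj),
    Module.finrank_fintype_fun_eq_card, Fintype.card_coe]

end FaceHomology

/-! ### Independence of the distinguished vertex -/

section Rotation

variable {K : Type*} [Field K] {V : Type*} {H : Hypergraph V}

theorem merge_sub_merge {p : ℕ} (i a x : Fin (p + 2)) :
    merge (i - a) (x - a) = merge i x - merge i a := by
  apply Fin.ext
  have := x.isLt
  have := i.isLt
  have := a.isLt
  have h1 := (merge i x).isLt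
  have h2 := (merge i a).isLt
  rw [merge_val]
  simp only [Fin.sub_def, merge_val] at *
  -- All remainders are of numbers below twice the modulus. This turns them into case distinctions
  -- that linear arithmetic can settle.
  have hmod : ∀ m c : ℕ, c < 2 * m → c % m = if c < m then c else c - m := by
    intro m c h
    split_ifs with h'
    · exact Nat.mod_eq_of_lt h'
    · rw [Nat.mod_eq_sub_mod (by omega), Nat.mod_eq_of_lt (by omega)]
  rw [hmod (p + 2) (p + 2 - a + x) (by omega), hmod (p + 2) (p + 2 - a + i) (by omega),
    hmod (p + 1) _ (by omega)]
  split_ifs <;> omega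

/-- One rotation of `p + 1` blocks costs `(-1) ^ p`. This is the sign identity that makes
`rotateChain` commute with the boundary, with `a` the index of the new first block. -/
theorem rotate_sign {p : ℕ} (i a : Fin (p + 2)) :
    (-1 : K) ^ ((i - a : Fin (p + 2)) : ℕ) * (-1) ^ ((p + 1) * (a : ℕ)) =
      (-1) ^ (i : ℕ) * (-1) ^ (p * (merge i a : ℕ)) := by
  have := i.isLt
  have := a.isLt
  rw [← pow_add, ← pow_add]
  refine neg_one_pow_congr ?_
  rw [Nat.even_add, Nat.even_add, Nat.even_mul, Nat.even_mul, Nat.even_add_one, merge_val, Fin.sub_def]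
  simp only
  by_cases h : (a : ℕ) ≤ i
  · have : (p + 2 - a + i) % (p + 2) = i - a := by
      rw [Nat.mod_eq_sub_mod (by omega), Nat.mod_eq_of_lt (by omega)]; omega
    rw [this, if_pos h, Nat.even_sub h]
    split_ifs with h'
    · have h'' : (i : ℕ) = p + 1 := by omega
      rw [h', h'', Nat.even_add_one]
      simp
    · tauto
  · have : (p + 2 - a + i) % (p + 2) = p + 2 - a + i := Nat.mod_eq_of_lt (by omega)
    rw [this, if_neg h, Nat.even_add, Nat.even_sub (by omega), Nat.even_sub (by omega),
      Nat.even_add]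
    simp only [even_two, iff_true]
    tauto

/-- Rotate the blocks of a face such that the block of `v₁` becomes the first. -/
def rotateFace {v₀ : V} (v₁ : V) {p : ℕ} (f : Face H v₀ p) : Face H v₁ p :=
  ⟨fun v => f.1 v - f.1 v₁, fun j => by
    obtain ⟨v, hv⟩ := f.2.1 (j + f.1 v₁)
    exact ⟨v, by simp only [hv, add_sub_cancel_right]⟩, sub_self _, by
    obtain ⟨e, he, i, hi⟩ := f.2.2.2
    exact ⟨e, he, i - f.1 v₁, fun v hv => by simp only [hi v hv]⟩⟩

theorem mergeFace_rotateFace {v₀ : V} (v₁ : V) {p : ℕ} (i : Fin (p + 2))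
    (f : Face H v₀ (p + 1)) :
    mergeFace (i - f.1 v₁) (rotateFace v₁ f) = rotateFace v₁ (mergeFace i f) :=
  Subtype.ext (funext fun v => merge_sub_merge i (f.1 v₁) (f.1 v))

theorem rotateFace_rotateFace {v₀ : V} (v₁ : V) {p : ℕ} (f : Face H v₀ p) :
    rotateFace v₀ (rotateFace v₁ f) = f :=
  Subtype.ext (funext fun v => by simp [rotateFace, f.2.2.1])

/-- The identification of the chain spaces for two choices of the distinguished vertex. -/
noncomputable def rotateChain (K : Type*) [Field K] (H : Hypergraph V) (v₀ v₁ : V) (p : ℕ) :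
    Chain K H v₀ p →ₗ[K] Chain K H v₁ p :=
  Finsupp.linearCombination K fun f =>
    Finsupp.single (rotateFace v₁ f) ((-1 : K) ^ (p * (f.1 v₁ : ℕ)))

theorem rotateChain_single (v₀ v₁ : V) (p : ℕ) (f : Face H v₀ p) (a : K) :
    rotateChain K H v₀ v₁ p (Finsupp.single f a) =
      Finsupp.single (rotateFace v₁ f) (a * (-1 : K) ^ (p * (f.1 v₁ : ℕ))) := by
  simp [rotateChain]

theorem rotateChain_rotateChain (v₀ v₁ : V) (p : ℕ) (z : Chain K H v₀ p) :
    rotateChain K H v₁ v₀ p (rotateChain K H v₀ v₁ p z) = z := by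
  refine LinearMap.congr_fun (f := rotateChain K H v₁ v₀ p ∘ₗ rotateChain K H v₀ v₁ p)
    (g := LinearMap.id) (Finsupp.lhom_ext fun f a => ?_) z
  rw [LinearMap.comp_apply, rotateChain_single, rotateChain_single, rotateFace_rotateFace,
    LinearMap.id_apply, mul_assoc, ← pow_add, ← mul_add]
  have h : (rotateFace v₁ f).1 v₀ = - f.1 v₁ := by simp [rotateFace, f.2.2.1]
  have heven : Even (p * ((f.1 v₁ : ℕ) + ((- f.1 v₁ : Fin (p + 1)) : ℕ))) := by
    rw [Fin.val_neg]
    split_ifs with h0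
    · simp [h0]
    · rw [Nat.add_sub_cancel' (f.1 v₁).isLt.le]
      exact Nat.even_mul_succ_self p
  rw [h, heven.neg_one_pow, mul_one]

theorem boundary_rotateChain (v₀ v₁ : V) (p : ℕ) (z : Chain K H v₀ (p + 1)) :
    boundary K H v₁ p (rotateChain K H v₀ v₁ (p + 1) z) =
      rotateChain K H v₀ v₁ p (boundary K H v₀ p z) := by
  refine LinearMap.congr_fun (f := boundary K H v₁ p ∘ₗ rotateChain K H v₀ v₁ (p + 1))
    (g := rotateChain K H v₀ v₁ p ∘ₗ boundary K H v₀ p) (Finsupp.lhom_ext fun f a => ?_) z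
  rw [LinearMap.comp_apply, LinearMap.comp_apply, rotateChain_single, boundary_single,
    boundary_single, map_sum, ← Equiv.sum_comp (Equiv.subRight (f.1 v₁))]
  refine Finset.sum_congr rfl fun i _ => ?_
  rw [rotateChain_single, Equiv.subRight_apply, mergeFace_rotateFace]
  congr 1
  have := rotate_sign (K := K) i (f.1 v₁)
  rw [mul_left_comm, this, mul_comm ((-1 : K) ^ (i : ℕ)) a, mul_assoc]
  rfl

/-- `rotateChain` as a linear equivalence. -/
noncomputable def rotateEquiv (K : Type*) [Field K] (H : Hypergraph V) (v₀ v₁ : V) (p : ℕ) :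
    Chain K H v₀ p ≃ₗ[K] Chain K H v₁ p :=
  LinearEquiv.ofLinearMap (rotateChain K H v₀ v₁ p) (rotateChain K H v₁ v₀ p)
    (LinearMap.ext (rotateChain_rotateChain v₁ v₀ p))
    (LinearMap.ext (rotateChain_rotateChain v₀ v₁ p))

theorem map_rotateEquiv_cycles (v₀ v₁ : V) (p : ℕ) :
    (cycles K H v₀ p).map (rotateEquiv K H v₀ v₁ p).toLinearMap = cycles K H v₁ p := by
  rcases p with _ | p
  · simp [cycles]
  · ext z
    rw [Submodule.mem_map_equiv]
    simp only [cycles, LinearMap.mem_ker]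
    change boundary K H v₀ p (rotateChain K H v₁ v₀ (p + 1) z) = 0 ↔ _
    rw [boundary_rotateChain]
    exact map_eq_zero_iff _ (rotateEquiv K H v₁ v₀ p).injective

theorem map_rotateEquiv_range (v₀ v₁ : V) (p : ℕ) :
    (LinearMap.range (boundary K H v₀ p)).map (rotateEquiv K H v₀ v₁ p).toLinearMap =
      LinearMap.range (boundary K H v₁ p) := by
  ext z
  constructor
  · rintro ⟨_, ⟨y, rfl⟩, rfl⟩
    exact ⟨rotateChain K H v₀ v₁ (p + 1) y, boundary_rotateChain v₀ v₁ p y⟩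
  · rintro ⟨y, rfl⟩
    refine ⟨_, ⟨rotateChain K H v₁ v₀ (p + 1) y, rfl⟩, ?_⟩
    change rotateChain K H v₀ v₁ p _ = _
    rw [← boundary_rotateChain, rotateChain_rotateChain]

theorem finrank_subquotient_map {M M' : Type*} [AddCommGroup M] [Module K M] [AddCommGroup M']
    [Module K M'] (e : M ≃ₗ[K] M') (Z B : Submodule K M) :
    Module.finrank K (Subquotient (Z.map e.toLinearMap) (B.map e.toLinearMap)) =
      Module.finrank K (Subquotient Z B) := by
  refine (Submodule.Quotient.equiv _ _ (e.submoduleMap Z) ?_).finrank_eq.symm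
  ext ⟨z, hz⟩
  simp only [Submodule.submoduleOf, Submodule.mem_map, Submodule.mem_comap]
  constructor
  · rintro ⟨y, hy, hyz⟩
    exact ⟨y, hy, congrArg Subtype.val hyz⟩
  · rintro ⟨y, hy, hyz⟩
    obtain ⟨x, hx, hxz⟩ := hz
    have : y = x := e.injective (hyz.trans hxz.symm)
    exact ⟨⟨x, hx⟩, this ▸ hy, Subtype.ext hxz⟩

theorem finrank_homology_rotate (v₀ v₁ : V) (p : ℕ) :
    Module.finrank K (Subquotient (cycles K H v₁ p) (LinearMap.range (boundary K H v₁ p))) =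
      Module.finrank K (Subquotient (cycles K H v₀ p) (LinearMap.range (boundary K H v₀ p))) := by
  rw [← map_rotateEquiv_cycles v₀ v₁, ← map_rotateEquiv_range v₀ v₁, finrank_subquotient_map]

end Rotation

/-! ### Star hypergraphs: hyperedges, avoiding sets and colorings -/

section Star

variable {V : Type*} {H : Hypergraph V} {k : ℕ} {S : Set V}

/-- A hyperedge has exactly one vertex beyond the core, by size. Conversely a leaf lies in some
hyperedge, which can only be the core with that leaf. -/
theorem IsStarHypergraph.mem_edgeSet_iff (h : IsStarHypergraph H k S) {e : Set V} :
    e ∈ H.edgeSet ↔ ∃ v ∈ H.vertexSet \ S, e = insert v S := by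
  have key : ∀ e ∈ H.edgeSet, ∃ v ∈ H.vertexSet \ S, e = insert v S := by
    intro e he
    have hk := h.core_card
    have hek := h.uniform e he
    have hSe := h.core_subset e he
    have h1 : (e \ S).ncard = 1 := by
      rw [Set.ncard_sdiff hSe h.core_finite]
      omega
    obtain ⟨v, hv⟩ := Set.ncard_eq_one.1 h1
    have hv' : v ∈ e \ S := hv ▸ Set.mem_singleton v
    refine ⟨v, ⟨H.subset_vertexSet_of_mem_edgeSet he hv'.1, hv'.2⟩, ?_⟩
    rw [← Set.singleton_union, ← hv, Set.sdiff_union_of_subset hSe]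
  refine ⟨key e, ?_⟩
  rintro ⟨v, ⟨hv, hvS⟩, rfl⟩
  obtain ⟨e, he, hve⟩ := h.no_singleton v hv
  obtain ⟨w, hw, rfl⟩ := key e he
  rcases hve with rfl | hve
  · exact he
  · exact absurd hve hvS

theorem IsStarHypergraph.ncard_leaves [Finite V] (h : IsStarHypergraph H k S)
    (hne : H.edgeSet.Nonempty) : (H.vertexSet \ S).ncard + k = H.vertexSet.ncard + 1 := by
  obtain ⟨e, he⟩ := hne
  have := Set.ncard_sdiff_add_ncard_of_subset
    ((h.core_subset e he).trans (H.subset_vertexSet_of_mem_edgeSet he))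
  have := h.core_card
  omega

theorem IsStarHypergraph.ncard_edgeSet_le [Finite V] (h : IsStarHypergraph H k S) :
    H.edgeSet.ncard ≤ (H.vertexSet \ S).ncard := by
  have : H.edgeSet = (fun v => insert v S) '' (H.vertexSet \ S) := by
    ext e
    rw [h.mem_edgeSet_iff]
    simp only [Set.mem_image, eq_comm]
  rw [this]
  exact Set.ncard_image_le

end Star

theorem card_filter_powersetCard_superset {V : Type*} [DecidableEq V] {A M : Finset V}
    (hM : M ⊆ A) (p : ℕ) :
    ((A.powersetCard p).filter fun U => M ⊆ U).card =
      if M.card ≤ p then (A.card - M.card).choose (p - M.card) else 0 := by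
  split_ifs with h
  · rw [← Finset.card_sdiff_of_subset hM, ← Finset.card_powersetCard]
    refine Finset.card_nbij' (fun U => U \ M) (fun U => U ∪ M) ?_ ?_ ?_ ?_
    · intro U hU
      simp only [Finset.coe_filter, Set.mem_ofPred_eq, Finset.mem_powersetCard, Finset.mem_coe] at hU ⊢
      exact ⟨Finset.sdiff_subset_sdiff hU.1.1 le_rfl, by
        rw [Finset.card_sdiff_of_subset hU.2, hU.1.2]⟩
    · intro U hU
      simp only [Finset.coe_filter, Set.mem_ofPred_eq, Finset.mem_powersetCard, Finset.mem_coe] at hU ⊢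
      have hd : Disjoint U M := Finset.disjoint_of_subset_left hU.1 Finset.sdiff_disjoint
      refine ⟨⟨Finset.union_subset (hU.1.trans Finset.sdiff_subset) hM, ?_⟩,
        Finset.subset_union_right⟩
      rw [Finset.card_union_of_disjoint hd, hU.2]
      omega
    · intro U hU
      simp only [Finset.coe_filter, Set.mem_ofPred_eq] at hU
      exact Finset.sdiff_union_of_subset hU.2
    · intro U hU
      simp only [Finset.mem_coe, Finset.mem_powersetCard] at hU
      have hd : Disjoint U M := Finset.disjoint_of_subset_left hU.1 Finset.sdiff_disjoint
      exact Finset.union_sdiff_cancel_right hd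
  · rw [Finset.card_eq_zero, Finset.filter_eq_empty_iff]
    intro U hU hMU
    have := Finset.card_le_card hMU
    rw [(Finset.mem_powersetCard.1 hU).2] at this
    exact h this

section StarHomology

variable {V : Type*} {H : Hypergraph V} {S M : Set V}

theorem contractVertex_image_insert {v : V} (hv : v ∉ S) (hS : S.Nonempty) :
    contractVertex S '' insert v S = {none, some ⟨v, hv⟩} := by
  have h1 : contractVertex S v = some ⟨v, hv⟩ := by simp [contractVertex, hv]
  have h2 : contractVertex S '' S = {none} := by
    ext x
    constructor
    · rintro ⟨y, hy, rfl⟩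
      simp [contractVertex, hy]
    · rintro rfl
      obtain ⟨y, hy⟩ := hS
      exact ⟨y, hy, by simp [contractVertex, hy]⟩
  rw [Set.image_insert_eq, h1, h2, Set.pair_comm]

theorem ncard_subtype_leaves (hMS : Disjoint M S) :
    {v : {v : V // v ∉ S} | v.1 ∈ M}.ncard = M.ncard := by
  rw [← Set.ncard_image_of_injective _ Subtype.val_injective]
  congr 1
  ext v
  constructor
  · rintro ⟨w, hw, rfl⟩
    exact hw
  · intro hv
    exact ⟨⟨v, Set.disjoint_left.1 hMS hv⟩, hv, rfl⟩

theorem contractedGraph_adj_iff (hMS : Disjoint M S) (hS : S.Nonempty)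
    (hE : ∀ e, e ∈ H.edgeSet ↔ ∃ v ∈ M, e = insert v S) (a b : ContractedVertex S) :
    (contractedGraph H S).Adj a b ↔
      (a = none ∧ ∃ v, b = some v ∧ v.1 ∈ M) ∨ (b = none ∧ ∃ v, a = some v ∧ v.1 ∈ M) := by
  change (a ≠ b ∧ ∃ e ∈ H.edgeSet, contractVertex S '' e = {a, b}) ↔ _
  constructor
  · rintro ⟨_, e, he, heq⟩
    obtain ⟨v, hv, rfl⟩ := (hE e).1 he
    have hvS := Set.disjoint_left.1 hMS hv
    rw [contractVertex_image_insert hvS hS, Set.pair_eq_pair_iff] at heq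
    rcases heq with ⟨rfl, rfl⟩ | ⟨rfl, rfl⟩
    · exact Or.inl ⟨rfl, _, rfl, hv⟩
    · exact Or.inr ⟨rfl, _, rfl, hv⟩
  · rintro (⟨rfl, v, rfl, hv⟩ | ⟨rfl, v, rfl, hv⟩)
    · exact ⟨by simp, _, (hE _).2 ⟨v, hv, rfl⟩, contractVertex_image_insert v.2 hS⟩
    · exact ⟨by simp, _, (hE _).2 ⟨v, hv, rfl⟩, by
        rw [contractVertex_image_insert v.2 hS, Set.pair_comm]⟩

variable [Fintype V]

/-- A set avoids a hyperedge exactly when it misses `S` and some leaf. The complementary count is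
that of the sets outside `S` containing all of `M`. -/
theorem card_avoidingSets_add (hMS : Disjoint M S)
    (hE : ∀ e, e ∈ H.edgeSet ↔ ∃ v ∈ M, e = insert v S) (p : ℕ) :
    ((avoidingSets H).filter fun U => U.card = p).card +
        (if M.ncard ≤ p then (Fintype.card V - S.ncard - M.ncard).choose (p - M.ncard) else 0) =
      (Fintype.card V - S.ncard).choose p := by
  classical
  rw [Set.ncard_eq_toFinset_card' M, Set.ncard_eq_toFinset_card' S, ← Finset.card_compl,
    ← card_filter_powersetCard_superset, ← Finset.card_powersetCard,
    ← Finset.card_filter_add_card_filter_not (s := S.toFinsetᶜ.powersetCard p)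
      (fun U => ¬ M.toFinset ⊆ U)]
  · congr 2
    · ext U
      simp only [Finset.mem_filter, mem_avoidingSets, hE, Finset.mem_powersetCard]
      constructor
      · rintro ⟨⟨e, ⟨v, hv, rfl⟩, h⟩, hp⟩
        refine ⟨⟨fun x hx => ?_, hp⟩, fun h' => ?_⟩
        · rw [Finset.mem_compl, Set.mem_toFinset]
          exact fun hxS => h x (Set.mem_insert_of_mem v hxS) hx
        · exact h v (Set.mem_insert v S) (h' (Set.mem_toFinset.2 hv))
      · rintro ⟨⟨h1, hp⟩, h2⟩
        obtain ⟨v, hv, hvU⟩ := Finset.not_subset.1 h2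
        refine ⟨⟨_, ⟨v, Set.mem_toFinset.1 hv, rfl⟩, ?_⟩, hp⟩
        rintro x (rfl | hx) hxU
        · exact hvU hxU
        · have := h1 hxU
          rw [Finset.mem_compl, Set.mem_toFinset] at this
          exact this hx
    · simp
  · intro v hv
    rw [Set.mem_toFinset] at hv
    rw [Finset.mem_compl, Set.mem_toFinset]
    exact Set.disjoint_left.1 hMS hv

/-- A proper coloring of a star with isolated vertices is a color of the center and a compatible
choice of colors of the other vertices. -/
def coloringEquiv (hMS : Disjoint M S) (hS : S.Nonempty)
    (hE : ∀ e, e ∈ H.edgeSet ↔ ∃ v ∈ M, e = insert v S) (α : Type*) :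
    (contractedGraph H S).Coloring α ≃
      Σ a : α, ∀ v : {v : V // v ∉ S}, {b : α // v.1 ∈ M → b ≠ a} where
  toFun c := ⟨c none, fun v => ⟨c (some v), fun hv h => c.valid
    ((contractedGraph_adj_iff hMS hS hE none (some v)).2 (Or.inl ⟨rfl, v, rfl, hv⟩)) h.symm⟩⟩
  invFun x := SimpleGraph.Coloring.mk (fun w => w.elim x.1 fun v => (x.2 v).1) (by
    intro a b hab
    rcases (contractedGraph_adj_iff hMS hS hE a b).1 hab with ⟨rfl, v, rfl, hv⟩ | ⟨rfl, v, rfl, hv⟩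
    · exact ((x.2 v).2 hv).symm
    · exact (x.2 v).2 hv)
  left_inv c := by
    apply DFunLike.ext
    rintro (_ | v) <;> rfl
  right_inv x := rfl

theorem card_notMem (S : Set V) : Nat.card {v : V // v ∉ S} = Fintype.card V - S.ncard := by
  rw [← Nat.card_eq_fintype_card, ← Set.ncard_compl]
  rfl

theorem card_coloring_contractedGraph (hMS : Disjoint M S) (hS : S.Nonempty)
    (hE : ∀ e, e ∈ H.edgeSet ↔ ∃ v ∈ M, e = insert v S) (c : ℕ) :
    Nat.card ((contractedGraph H S).Coloring (Fin c)) =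
      c ^ (Fintype.card V - S.ncard - M.ncard + 1) * (c - 1) ^ M.ncard := by
  classical
  rw [Nat.card_congr (coloringEquiv hMS hS hE (Fin c)), Nat.card_sigma]
  have h1 : ∀ (a : Fin c) (v : {v : V // v ∉ S}),
      Nat.card {b : Fin c // v.1 ∈ M → b ≠ a} = if v.1 ∈ M then c - 1 else c := by
    intro a v
    rw [Nat.card_eq_fintype_card]
    split_ifs with h
    · simp [h]
    · simp [h]
  simp only [Nat.card_pi, h1, Finset.prod_ite, Finset.prod_const, Finset.sum_const,
    Finset.card_univ, Fintype.card_fin, smul_eq_mul]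
  have h2 : (Finset.univ.filter fun v : {v : V // v ∉ S} => v.1 ∈ M).card = M.ncard := by
    rw [← ncard_subtype_leaves hMS, Set.ncard_eq_toFinset_card']
    congr 1
    ext
    simp
  have h3 : (Finset.univ.filter fun v : {v : V // v ∉ S} => v.1 ∉ M).card =
      Fintype.card V - S.ncard - M.ncard := by
    have := Finset.card_filter_add_card_filter_not (s := Finset.univ)
      (fun v : {v : V // v ∉ S} => v.1 ∈ M)
    rw [h2, Finset.card_univ, ← Nat.card_eq_fintype_card, card_notMem] at this
    omega
  rw [h2, h3, pow_succ]
  ring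

theorem chromaticPolynomial_contractedGraph (hMS : Disjoint M S) (hS : S.Nonempty)
    (hE : ∀ e, e ∈ H.edgeSet ↔ ∃ v ∈ M, e = insert v S) :
    chromaticPolynomial (contractedGraph H S) =
      X ^ (Fintype.card V - S.ncard - M.ncard + 1) * (X - 1) ^ M.ncard := by
  refine eq_of_infinite_eval_eq _ _ (Set.Infinite.mono ?_
    (Set.infinite_range_of_injective (Nat.cast_injective (R := ℚ))))
  rintro _ ⟨c, rfl⟩
  rw [Set.mem_ofPred_eq, chromaticPolynomial_eval, card_coloring_contractedGraph hMS hS hE]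
  -- At `c = 0` the natural number `c - 1` is truncated, but the factor with positive exponent makes
  -- both sides vanish.
  rcases c with _ | c
  · simp
  · simp

/-- The `s`-th derivative at `0` divided by `s!` is the coefficient of `X ^ s`, here `(-1) ^ m`.
This is what gives `D = 1`. -/
theorem abs_iterate_derivative_eval_zero (s m : ℕ) :
    |(derivative^[s] (X ^ s * (X - 1) ^ m : ℚ[X])).eval 0| / (s.factorial : ℚ) = 1 := by
  have hs : (s.factorial : ℚ) ≠ 0 := by exact_mod_cast s.factorial_ne_zero
  rw [← coeff_zero_eq_eval_zero, coeff_iterate_derivative, zero_add, coeff_X_pow_mul',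
    if_pos le_rfl, Nat.sub_self, coeff_zero_eq_eval_zero, Nat.descFactorial_self]
  simp [abs_mul, hs]

end StarHomology

end CyclicColoring

open CyclicColoring in
theorem corollary4p2 {K : Type*} [Field K] [CharZero K] {V : Type*} [Fintype V] (v₀ : V)
    (n k l : ℕ) (hn : Fintype.card V = n) (hk : 2 ≤ k)
    (starH H : Hypergraph V) (S : Set V)
    (hstar : CyclicColoring.IsStarHypergraph starH k S)
    (hl : starH.vertexSet.ncard = l)
    (hedges : 2 ≤ starH.edgeSet.ncard)
    (hHV : H.vertexSet = Set.univ)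
    (hHE : H.edgeSet = starH.edgeSet)
    (D : ℚ)
    (hD : D = |(Polynomial.derivative^[n - l + 1]
        (CyclicColoring.chromaticPolynomial (CyclicColoring.contractedGraph H S))).eval 0| /
          ((n - l + 1).factorial : ℚ)) :
    Nat.card (CyclicColoring.ContractedVertex S) + k = n + 2 ∧
    (Module.finrank K (CyclicColoring.HC K H v₀ ((n : ℤ) - k - 1)) : ℚ) =
      D + ((l : ℚ) - k) ∧
    (∀ r : ℤ, (l : ℤ) - k - 1 ≤ r →
      (Module.finrank K (CyclicColoring.HC K H v₀ r) : ℚ) =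
        (CyclicColoring.binom (n - k + 1) (r + 1) : ℚ)
          - (CyclicColoring.binom (n - l + 1) ((n : ℤ) - k - r) : ℚ)
          + (CyclicColoring.binom (n - l) ((n : ℤ) - k - (r + 1)) : ℚ) * D) ∧
    (∀ r : ℤ, -1 ≤ r → r < (l : ℤ) - k - 1 →
      Module.finrank K (CyclicColoring.HC K H v₀ r) =
        CyclicColoring.binom (n - k + 1) (r + 1)) := by
  classical
  have hSk := hstar.core_card
  have hS : S.Nonempty := (Set.ncard_pos hstar.core_finite).1 (by omega)
  have hMS : Disjoint (starH.vertexSet \ S) S := Set.disjoint_sdiff_left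
  have hE : ∀ e, e ∈ H.edgeSet ↔ ∃ v ∈ starH.vertexSet \ S, e = insert v S := fun e => by
    rw [hHE, hstar.mem_edgeSet_iff]
  have hne : starH.edgeSet.Nonempty := Set.nonempty_of_ncard_ne_zero (by omega)
  have hleaves := hstar.ncard_leaves hne
  have hm := hedges.trans hstar.ncard_edgeSet_le
  have hln : l ≤ n := by
    rw [← hl, ← hn, ← Nat.card_eq_fintype_card]
    exact Set.ncard_le_card _
  rw [hl] at hleaves
  generalize hM : starH.vertexSet \ S = M at *
  have hcard : Fintype.card V - S.ncard = n - k + 1 := by omega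
  have hrest : n - k + 1 - M.ncard = n - l := by omega
  have hD1 : D = 1 := by
    rw [hD, chromaticPolynomial_contractedGraph hMS hS hE, hcard, hrest]
    exact abs_iterate_derivative_eval_zero _ _
  obtain ⟨v₁, hv₁⟩ := hS
  -- The count of avoiding sets, written additively to avoid truncated subtraction. It is
  -- transported from the core vertex `v₁` to the given `v₀`.
  have hdim : ∀ p : ℕ, Module.finrank K
      (Subquotient (cycles K H v₀ p) (LinearMap.range (boundary K H v₀ p))) +
        (if M.ncard ≤ p then (n - l).choose (p - M.ncard) else 0) = (n - k + 1).choose p := by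
    intro p
    have := card_avoidingSets_add hMS hE p
    rw [hcard, hrest] at this
    rw [← this, finrank_homology_rotate v₁ v₀, finrank_homology_of_mem_edges]
    intro e he
    obtain ⟨v, _, rfl⟩ := (hE e).1 he
    exact Set.mem_insert_of_mem v hv₁
  have hHC : ∀ (r : ℤ) (p : ℕ), r + 1 = p → Module.finrank K (HC K H v₀ r) +
      (if M.ncard ≤ p then (n - l).choose (p - M.ncard) else 0) = (n - k + 1).choose p := by
    intro r p h
    have : (r + 1).toNat = p := by omega
    rw [← hdim p, ← this]
  have hbinom : ∀ a b : ℕ, binom a b = a.choose b := fun a b => by simp [binom]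
  have hbinom_neg : ∀ (a : ℕ) (b : ℤ), b < 0 → binom a b = 0 := fun a b h => by
    rw [binom, if_neg (by omega)]
  refine ⟨?_, ?_, fun r hr => ?_, fun r hr1 hr => ?_⟩
  · rw [Finite.card_option, card_notMem, hcard]
    omega
  · have h := hHC ((n : ℤ) - k - 1) (n - k) (by omega)
    have h' : Module.finrank K (HC K H v₀ ((n : ℤ) - k - 1)) + k = l + 1 := by
      rw [Nat.choose_succ_self_right] at h
      -- The condition `hp` holds when there are isolated vertices, and the correction term is then
      -- `n - l`. Otherwise `l = n` and the term is absent.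
      split_ifs at h with hp
      · have h1 : n - l = n - k - M.ncard + 1 := by omega
        rw [h1, Nat.choose_succ_self_right] at h
        omega
      · omega
    have h'' : (Module.finrank K (HC K H v₀ ((n : ℤ) - k - 1)) : ℚ) + k = l + 1 := by
      exact_mod_cast h'
    rw [hD1]
    linarith
  · obtain ⟨p, hp⟩ : ∃ p : ℕ, r + 1 = p := ⟨(r + 1).toNat, by omega⟩
    have h := hHC r p hp
    generalize Module.finrank K (HC K H v₀ r) = d at h ⊢
    rw [hD1, mul_one, hp, hbinom, ← h]
    -- This is Pascal's rule for the lower entry `n - k - r = (n - k - p) + 1`, with one summand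
    -- reflected by `p - #M + (n - k - r) = n - l`.
    suffices hs : (if M.ncard ≤ p then (n - l).choose (p - M.ncard) else 0) +
        binom (n - l) ((n : ℤ) - k - p) = binom (n - l + 1) ((n : ℤ) - k - r) by
      rw [← hs]
      push_cast
      ring
    rcases le_or_gt p (n - k) with h1 | h1
    · obtain ⟨b, hb⟩ : ∃ b : ℕ, n - k = p + b := ⟨n - k - p, by omega⟩
      have e1 : (n : ℤ) - k - p = b := by omega
      have e2 : (n : ℤ) - k - r = (b + 1 : ℕ) := by omega
      rw [e1, e2, hbinom, hbinom, Nat.choose_succ_succ, add_comm]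
      congr 1
      split_ifs with h2
      · exact Nat.choose_symm_of_eq_add (by omega)
      -- The boundary value `p = #M - 1`, where the lower entry is `n - l + 1`.
      · exact (Nat.choose_eq_zero_of_lt (by omega)).symm
    · rw [hbinom_neg _ ((n : ℤ) - k - p) (by omega), add_zero, if_pos (by omega)]
      -- For `p = n - k + 1` both sides are `1`; beyond that both vanish.
      rcases (Nat.succ_le_of_lt h1).eq_or_lt with h2 | h2
      · have e2 : (n : ℤ) - k - r = (0 : ℕ) := by omega
        have e3 : p - M.ncard = n - l := by omega
        rw [e2, hbinom, e3, Nat.choose_self, Nat.choose_zero_right]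
      · rw [hbinom_neg _ _ (by omega), Nat.choose_eq_zero_of_lt (by omega)]
  · obtain ⟨p, hp⟩ : ∃ p : ℕ, r + 1 = p := ⟨(r + 1).toNat, by omega⟩
    have h := hHC r p hp
    -- In this range `p` is less than `#M = l - k + 1`, so no set of size `p` contains all leaves.
    rw [if_neg (by omega), add_zero] at h
    generalize Module.finrank K (HC K H v₀ r) = d at h ⊢
    rw [h, hp, hbinom]
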